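/- **Setting.** Let $\mathbb T$ be the unit circle, $1<p<\infty$, $1/p+1/q=1$, and let $\beta\in\mathbb C$ with $|\beta|>1$, $\lambda:=i\sqrt{|\beta|^2-1}$, $\alpha(t):=\dfrac{t-\beta}{\overline\beta t-1}$ (an involution of $\mathbb T$ reversing the orientation), $\alpha_-(t):=\dfrac{\lambda t}{\overline\beta t-1}$, and $g_\alpha:=g\circ\alpha$ for functions $g$ on $\mathbb T$. Let $H^p=\{f\in L^p(\mathbb T):\widehat f_n=0 \text{ for } n<0\}$ and $\overline{H^p}=\{f\in L^p(\mathbb T):\widehat f_n=0\text{ for }n>0\}$, let $P:\sum_{n\in\mathbb Z}\widehat f_nt^n\mapsto\sum_{n\ge0}\widehat f_nt^n$ be the analytic projection on $L^p$, $Q=I-P$, and $(J_\alpha f)(t)=t^{-1}\alpha_-(t)f(\alpha(t))$. For $a,b\in L^\infty$ define on $H^p$ the operators $T(a)f=P(af)$ and $H_\alpha(b)f=P(b\,Q J_\alpha f)$. For a bounded operator $A$ on $H^p$ let $\operatorname{coker}A:=\ker A^*$, where $A^*$ is the adjoint on the dual space, and, if $A$ is Fredholm, $\operatorname{ind}A=\dim\ker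 A-\dim\operatorname{coker}A$. A pair $(a,b)\in L^\infty\times L^\infty$ with $a$ invertible in $L^\infty$ is a *matching pair* if $a a_\alpha=b b_\alpha$ almost everywhere on $\mathbb T$; then $b$ is invertible in $L^\infty$, and we put $c:=ab^{-1}$, so that $cc_\alpha=1$. If $g\in L^\infty$, $gg_\alpha=1$ and $T(g)$ is Fredholm on $H^p$ with $n=\operatorname{ind}T(g)$, then $g$ has a unique Wiener–Hopf factorization $g=g_-t^{-n}g_+$ in $H^p$, that is, $g_+\in H^q$, $g_+^{-1}\in H^p$, $g_-\in\overline{H^p}$, $g_-^{-1}\in\overline{H^q}$, $g_-(\infty)=1$, and the operator $g_+^{-1}Pg_-^{-1}I$, defined on the polynomials in $t$, extends boundedly to $H^p$. The *$\alpha$-signature* of $g$ is $$\boldsymbol\sigma_\alpha(g):=\Bigl(\frac{\lambda}{\overline\beta}\Bigr)^{n}g_+^{-1}\Bigl(\frac1{\overline\beta}\Bigr)\in\{-1,1\}.$$ **Proposition 5.5.** Let $(a,b)$ be a matching pair, $c=ab^{-1}$, and let $T(c)$ be Fredholm on $H^p$. 1. If $\operatorname{ind}T(c)=1$ and $\boldsymbol\sigma_\alpha(c)=1$,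 then $\ker(T(a)+H_\alpha(b))=\{0\}$ or $\operatorname{coker}(T(a)+H_\alpha(b))=\{0\}$. 2. If $\operatorname{ind}T(c)=-1$ and $\boldsymbol\sigma_\alpha(c)=1$, then $\ker(T(a)-H_\alpha(b))=\{0\}$ or $\operatorname{coker}(T(a)-H_\alpha(b))=\{0\}$. 3. If $\operatorname{ind}T(c)=0$, then each of the two operators $A=T(a)+H_\alpha(b)$ and $A=T(a)-H_\alpha(b)$ satisfies $\ker A=\{0\}$ or $\operatorname{coker}A=\{0\}$. -/

import Mathlib

open MeasureTheory AddCircle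
open scoped ENNReal NNReal ComplexConjugate

noncomputable section

namespace ToeplitzHankel

instance factTwoPiPos : Fact ((0 : ℝ) < 2 * Real.pi) := ⟨Real.two_pi_pos⟩

/-- The unit circle; the point `θ` stands for `t = exp (i θ)`, which is `pt θ`. -/
abbrev Torus : Type := AddCircle (2 * Real.pi)

/-- The point `t = exp (i θ)` of the complex plane. -/
def pt (θ : Torus) : ℂ := (toCircle θ : ℂ)

/-- Normalized arc length on the unit circle. -/
abbrev mT : Measure Torus := haarAddCircle

lemma norm_pt (θ : Torus) : ‖pt θ‖ = 1 := Circle.norm_coe _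

lemma continuous_pt : Continuous pt := continuous_subtype_val.comp continuous_toCircle

lemma pt_injective : Function.Injective pt :=
  Subtype.val_injective.comp (injective_toCircle Real.two_pi_pos.ne')

/-! ### The shift -/

/-- The linear fractional map `z ↦ (z - β) / (conj β * z - 1)`. -/
def moebius (β z : ℂ) : ℂ := (z - β) / (conj β * z - 1)

lemma den_ne {β z : ℂ} (hβ : 1 < ‖β‖) (hz : ‖z‖ = 1) : conj β * z - 1 ≠ 0 := by
  intro h
  have h1 : ‖conj β * z‖ = 1 := by rw [sub_eq_zero.mp h]; simp
  rw [norm_mul, hz, RCLike.norm_conj, mul_one] at h1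
  exact hβ.ne' h1

lemma norm_moebius {β z : ℂ} (hβ : 1 < ‖β‖) (hz : ‖z‖ = 1) : ‖moebius β z‖ = 1 := by
  have hzz : conj z * z = 1 := by
    rw [mul_comm, Complex.mul_conj, Complex.normSq_eq_norm_sq, hz]; simp
  have h : conj β * z - 1 = -(z * conj (z - β)) := by
    rw [map_sub, mul_sub, mul_comm z (conj z), hzz]; ring
  have h2 : ‖conj β * z - 1‖ = ‖z - β‖ := by
    rw [h, norm_neg, norm_mul, hz, one_mul, RCLike.norm_conj]
  have h3 : ‖conj β * z - 1‖ ≠ 0 := norm_ne_zero_iff.mpr (den_ne hβ hz)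
  rw [moebius, norm_div, h2]
  exact div_self (h2 ▸ h3)

lemma moebius_moebius {β z : ℂ} (hβ : 1 < ‖β‖) (hz : ‖z‖ = 1) :
    moebius β (moebius β z) = z := by
  have h1 := den_ne hβ hz
  have h2 := den_ne hβ (norm_moebius hβ hz)
  have h3 : moebius β z * (conj β * z - 1) = z - β := div_mul_cancel₀ _ h1
  have h4 : (conj β * moebius β z - 1) * (conj β * z - 1) = 1 - conj β * β := by
    linear_combination conj β * h3
  have h5 : (moebius β z - β) * (conj β * z - 1) = z * (1 - conj β * β) := by
    linear_combination h3
  change (moebius β z - β) / (conj β * moebius β z - 1) = z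
  rw [div_eq_iff h2]
  apply mul_right_cancel₀ h1
  rw [h5, mul_assoc, h4]

/-- The shift `α` of the unit circle, in the coordinate `θ`; see `pt_shift`. -/
def shift (β : ℂ) (hβ : 1 < ‖β‖) (θ : Torus) : Torus :=
  (homeomorphCircle Real.two_pi_pos.ne').symm
    (⟨moebius β (pt θ), mem_sphere_zero_iff_norm.mpr (norm_moebius hβ (norm_pt θ))⟩ : Circle)

lemma pt_shift (β : ℂ) (hβ : 1 < ‖β‖) (θ : Torus) :
    pt (shift β hβ θ) = moebius β (pt θ) := by
  have h := (homeomorphCircle Real.two_pi_pos.ne').apply_symm_apply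
    (⟨moebius β (pt θ), mem_sphere_zero_iff_norm.mpr (norm_moebius hβ (norm_pt θ))⟩ : Circle)
  rw [homeomorphCircle_apply] at h
  exact congrArg (Subtype.val) h

lemma shift_shift (β : ℂ) (hβ : 1 < ‖β‖) (θ : Torus) : shift β hβ (shift β hβ θ) = θ := by
  apply pt_injective
  rw [pt_shift, pt_shift, moebius_moebius hβ (norm_pt θ)]

lemma continuous_shift (β : ℂ) (hβ : 1 < ‖β‖) : Continuous (shift β hβ) := by
  refine (Homeomorph.continuous _).comp (Continuous.subtype_mk ?_ _)
  exact Continuous.div (continuous_pt.sub continuous_const)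
    ((continuous_const.mul continuous_pt).sub continuous_const) (fun θ => den_ne hβ (norm_pt θ))

lemma measurable_shift (β : ℂ) (hβ : 1 < ‖β‖) : Measurable (shift β hβ) :=
  (continuous_shift β hβ).measurable

lemma lipschitz_moebius (β : ℂ) (hβ : 1 < ‖β‖) :
    ∃ K : ℝ≥0, LipschitzOnWith K (moebius β) (Metric.sphere 0 1) := by
  have h0 : 0 < ‖β‖ - 1 := by linarith
  have hlow : ∀ z : ℂ, ‖z‖ = 1 → ‖β‖ - 1 ≤ ‖conj β * z - 1‖ := by
    intro z hz
    have := norm_sub_norm_le (conj β * z) 1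
    rwa [norm_mul, hz, RCLike.norm_conj, mul_one, norm_one] at this
  set K : ℝ := ‖conj β * β - 1‖ / ((‖β‖ - 1) * (‖β‖ - 1)) with hK
  refine ⟨⟨K, by positivity⟩, LipschitzOnWith.of_dist_le_mul ?_⟩
  intro z hz w hw
  have hz1 : ‖z‖ = 1 := by simpa using hz
  have hw1 : ‖w‖ = 1 := by simpa using hw
  have hdz := den_ne hβ hz1
  have hdw := den_ne hβ hw1
  have key : moebius β z - moebius β w =
      (conj β * β - 1) * (z - w) / ((conj β * z - 1) * (conj β * w - 1)) := by
    rw [moebius, moebius, div_sub_div _ _ hdz hdw]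
    congr 1
    ring
  rw [dist_eq_norm, dist_eq_norm, key, norm_div, norm_mul, norm_mul]
  change _ ≤ K * _
  rw [hK, div_mul_eq_mul_div]
  have := hlow z hz1
  have := hlow w hw1
  gcongr

/-- One-dimensional Hausdorff measure of the image in the plane. -/
def arc : Measure Torus := Measure.comap pt (Measure.hausdorffMeasure 1 : Measure ℂ)

lemma measurableEmbedding_pt : MeasurableEmbedding pt :=
  (continuous_pt.isClosedEmbedding pt_injective).measurableEmbedding

lemma arc_apply (s : Set Torus) : arc s = Measure.hausdorffMeasure 1 (pt '' s) :=
  measurableEmbedding_pt.comap_apply _ s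

lemma arc_univ_lt_top : arc Set.univ < ∞ := by
  have hl : LipschitzWith 1 (fun x : ℝ => Complex.exp (Complex.I * x)) := by
    refine LipschitzWith.of_dist_le_mul fun x y => ?_
    have h := Real.norm_exp_I_mul_ofReal_sub_one_le (x := x - y)
    have e : Complex.exp (Complex.I * x) - Complex.exp (Complex.I * y) =
        Complex.exp (Complex.I * y) * (Complex.exp (Complex.I * ((x - y : ℝ) : ℂ)) - 1) := by
      rw [mul_sub, ← Complex.exp_add]; push_cast; ring_nf
    rw [dist_eq_norm, e, norm_mul, mul_comm Complex.I (y : ℂ), Complex.norm_exp_ofReal_mul_I,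
      one_mul, dist_eq_norm]
    simpa using h
  have hsub : pt '' Set.univ ⊆
      (fun x : ℝ => Complex.exp (Complex.I * x)) '' (Set.Icc 0 (0 + 2 * Real.pi)) := by
    rintro _ ⟨θ, -, rfl⟩
    obtain ⟨x, hx, rfl⟩ := AddCircle.coe_image_Icc_eq (2 * Real.pi) 0 ▸ Set.mem_univ θ
    refine ⟨x, hx, ?_⟩
    simp [pt, toCircle_apply_mk, Circle.coe_exp, mul_comm]
  rw [arc_apply]
  refine (measure_mono hsub).trans_lt ((hl.hausdorffMeasure_image_le zero_le_one _).trans_lt ?_)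
  rw [hausdorffMeasure_real, Real.volume_Icc]
  exact ENNReal.mul_lt_top (by simp) ENNReal.ofReal_lt_top

lemma arc_ne_zero : arc ≠ 0 := by
  intro h0
  have h : arc Set.univ = 0 := by rw [h0]; rfl
  rw [arc_apply] at h
  have hl : LipschitzWith 1 Complex.re := by
    refine LipschitzWith.of_dist_le_mul fun x y => ?_
    simpa [dist_eq_norm] using Complex.abs_re_le_norm (x - y)
  have h1 := hl.hausdorffMeasure_image_le zero_le_one (pt '' Set.univ)
  rw [h, mul_zero, hausdorffMeasure_real] at h1
  have hsub : Set.Icc (-1 : ℝ) 1 ⊆ Complex.re '' (pt '' Set.univ) := by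
    intro x hx
    refine ⟨_, ⟨((Real.arccos x : ℝ) : Torus), trivial, rfl⟩, ?_⟩
    have hpi : 2 * Real.pi ≠ 0 := Real.two_pi_pos.ne'
    rw [pt, toCircle_apply_mk, div_self hpi, one_mul, Circle.coe_exp, Complex.exp_ofReal_mul_I_re,
      Real.cos_arccos hx.1 hx.2]
  have h2 := (measure_mono hsub).trans h1
  norm_num [Real.volume_Icc] at h2

instance : IsFiniteMeasure arc := ⟨arc_univ_lt_top⟩

open scoped Pointwise in
instance : arc.IsAddLeftInvariant := by
  refine ⟨fun x => ?_⟩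
  ext s hs
  rw [Measure.map_apply (measurable_const_add x) hs, arc_apply, arc_apply]
  have hx : pt (-x) ≠ 0 := by
    rw [← norm_ne_zero_iff, norm_pt]; exact one_ne_zero
  have : pt '' ((fun y => x + y) ⁻¹' s) = pt (-x) • (pt '' s) := by
    ext z
    simp only [Set.mem_image, Set.mem_preimage, Set.mem_smul_set]
    constructor
    · rintro ⟨y, hy, rfl⟩
      exact ⟨_, ⟨_, hy, rfl⟩, by simp [pt, toCircle_neg, toCircle_add]⟩
    · rintro ⟨_, ⟨y, hy, rfl⟩, rfl⟩
      exact ⟨-x + y, by simpa using hy, by simp [pt, toCircle_neg, toCircle_add]⟩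
  rw [this, Measure.hausdorffMeasure_smul₀ zero_le_one hx]
  have : ‖pt (-x)‖₊ = 1 := by ext; exact norm_pt _
  simp [this]

/-- The shift distorts arc length by a bounded factor, so composition with it acts on `L^p`. -/
lemma map_shift_le (β : ℂ) (hβ : 1 < ‖β‖) :
    ∃ K : ℝ≥0, mT.map (shift β hβ) ≤ (K : ℝ≥0∞) • mT := by
  obtain ⟨K, hK⟩ := lipschitz_moebius β hβ
  refine ⟨K, ?_⟩
  set k : ℝ≥0 := Measure.addHaarScalarFactor arc mT with hk
  have hak : arc = k • mT := Measure.isAddLeftInvariant_eq_smul arc mT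
  have hk0 : k ≠ 0 := by
    intro h
    apply arc_ne_zero
    rw [hak, h, zero_smul]
  have hks : ∀ s, arc s = (k : ℝ≥0∞) * mT s := by
    intro s
    conv_lhs => rw [hak]
    rfl
  refine Measure.le_iff.mpr fun s hs => ?_
  rw [Measure.map_apply (measurable_shift β hβ) hs, Measure.smul_apply, smul_eq_mul]
  have h1 : arc (shift β hβ ⁻¹' s) ≤ K * arc s := by
    rw [arc_apply, arc_apply]
    have hsub : pt '' (shift β hβ ⁻¹' s) ⊆ moebius β '' (pt '' s) := by
      rintro _ ⟨θ, hθ, rfl⟩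
      exact ⟨_, ⟨_, hθ, rfl⟩, by rw [← pt_shift β hβ, shift_shift]⟩
    have hsph : pt '' s ⊆ Metric.sphere 0 1 := by
      rintro _ ⟨θ, -, rfl⟩
      simpa using norm_pt θ
    refine (measure_mono hsub).trans ?_
    simpa using (hK.mono hsph).hausdorffMeasure_image_le zero_le_one
  rw [hks, hks, mul_left_comm] at h1
  exact (ENNReal.mul_le_mul_iff_right (by simpa using hk0) (by simp)).mp h1

lemma quasi_shift (β : ℂ) (hβ : 1 < ‖β‖) :
    Measure.QuasiMeasurePreserving (shift β hβ) mT mT := by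
  obtain ⟨K, hK⟩ := map_shift_le β hβ
  exact ⟨measurable_shift β hβ, Measure.absolutelyContinuous_of_le_smul hK⟩

lemma memLp_comp_shift (β : ℂ) (hβ : 1 < ‖β‖) {p : ℝ≥0∞} {f : Torus → ℂ} (hf : MemLp f p mT) :
    MemLp (f ∘ shift β hβ) p mT := by
  obtain ⟨K, hK⟩ := map_shift_le β hβ
  exact MemLp.comp_of_map (hf.of_measure_le_smul (by simp) hK)
    (measurable_shift β hβ).aemeasurable

/-! ### Operators on `L^p` -/

section Operators

variable (p : ℝ≥0∞) [Fact (1 ≤ p)]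

/-- The space `L^p` of the unit circle. -/
abbrev LpT : Type := Lp ℂ p mT

/-- Composition with the shift on `L^p`, as a bare function. -/
def compShiftFun (β : ℂ) (hβ : 1 < ‖β‖) (f : LpT p) : LpT p :=
  MemLp.toLp (fun θ => f (shift β hβ θ)) (memLp_comp_shift β hβ (Lp.memLp f))

lemma coeFn_compShiftFun (β : ℂ) (hβ : 1 < ‖β‖) (f : LpT p) :
    compShiftFun p β hβ f =ᵐ[mT] fun θ => f (shift β hβ θ) :=
  MemLp.coeFn_toLp _

/-- Composition with the shift as a linear map. -/
def compShiftLin (β : ℂ) (hβ : 1 < ‖β‖) : LpT p →ₗ[ℂ] LpT p where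
  toFun := compShiftFun p β hβ
  map_add' f g := by
    apply Lp.ext
    filter_upwards [coeFn_compShiftFun p β hβ (f + g), coeFn_compShiftFun p β hβ f,
      coeFn_compShiftFun p β hβ g, Lp.coeFn_add (compShiftFun p β hβ f) (compShiftFun p β hβ g),
      (quasi_shift β hβ).ae (Lp.coeFn_add f g)] with θ h1 h2 h3 h4 h5
    rw [h1, h4, Pi.add_apply, h2, h3, h5, Pi.add_apply]
  map_smul' c f := by
    apply Lp.ext
    filter_upwards [coeFn_compShiftFun p β hβ (c • f), coeFn_compShiftFun p β hβ f,
      Lp.coeFn_smul c (compShiftFun p β hβ f),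
      (quasi_shift β hβ).ae (Lp.coeFn_smul c f)] with θ h1 h2 h3 h4
    rw [RingHom.id_apply, h1, h3, Pi.smul_apply, h2, h4, Pi.smul_apply]

lemma compShiftLin_bound (β : ℂ) (hβ : 1 < ‖β‖) :
    ∃ C : ℝ, ∀ f : LpT p, ‖compShiftLin p β hβ f‖ ≤ C * ‖f‖ := by
  obtain ⟨K, hK⟩ := map_shift_le β hβ
  refine ⟨((K : ℝ≥0∞) ^ (1 / p).toReal).toReal, fun f => ?_⟩
  have hf : AEStronglyMeasurable f (mT.map (shift β hβ)) :=
    (Lp.aestronglyMeasurable f).mono_ac (quasi_shift β hβ).absolutelyContinuous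
  have h : eLpNorm (f ∘ shift β hβ) p mT ≤ (K : ℝ≥0∞) ^ (1 / p).toReal * eLpNorm f p mT := by
    rw [← eLpNorm_map_measure hf (measurable_shift β hβ).aemeasurable]
    exact eLpNorm_le_of_measure_le_smul hK
  have hKt : (K : ℝ≥0∞) ^ (1 / p).toReal ≠ ∞ :=
    ENNReal.rpow_ne_top_of_nonneg ENNReal.toReal_nonneg ENNReal.coe_ne_top
  have e : ‖compShiftLin p β hβ f‖ = (eLpNorm (f ∘ shift β hβ) p mT).toReal :=
    Lp.norm_toLp _ (memLp_comp_shift β hβ (Lp.memLp f))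
  rw [e, Lp.norm_def, ← ENNReal.toReal_mul]
  exact ENNReal.toReal_mono (ENNReal.mul_ne_top hKt (Lp.eLpNorm_ne_top f)) h

/-- Composition with the shift, `f ↦ f ∘ α`, on `L^p`. -/
def compShift (β : ℂ) (hβ : 1 < ‖β‖) : LpT p →L[ℂ] LpT p :=
  (compShiftLin p β hβ).mkContinuousOfExistsBound (compShiftLin_bound p β hβ)

lemma coeFn_compShift (β : ℂ) (hβ : 1 < ‖β‖) (f : LpT p) :
    compShift p β hβ f =ᵐ[mT] fun θ => f (shift β hβ θ) :=
  coeFn_compShiftFun p β hβ f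

open scoped Classical in
/-- Multiplication by the function `a ∈ L^∞` on `L^p` (zero if `a ∉ L^∞`). -/
def mulOp (a : Torus → ℂ) : LpT p →L[ℂ] LpT p :=
  if ha : MemLp a ∞ mT then (ContinuousLinearMap.mul ℂ ℂ).holderL mT ∞ p p ha.toLp else 0

lemma coeFn_mulOp {a : Torus → ℂ} (ha : MemLp a ∞ mT) (f : LpT p) :
    mulOp p a f =ᵐ[mT] fun θ => a θ * f θ := by
  rw [mulOp, dif_pos ha, ContinuousLinearMap.holderL_apply_apply]
  filter_upwards [(ContinuousLinearMap.mul ℂ ℂ).coeFn_holder (r := p) ha.toLp f,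
    ha.coeFn_toLp] with θ h1 h2
  rw [h1, h2]
  rfl

/-- The constant `λ = i √(|β|² - 1)`. -/
def lam (β : ℂ) : ℂ := Complex.I * (Real.sqrt (‖β‖ ^ 2 - 1) : ℂ)

/-- The function `α₋(t) = λ t / (conj β * t - 1)`. -/
def alphaMinus (β : ℂ) (θ : Torus) : ℂ := lam β * pt θ / (conj β * pt θ - 1)

lemma memLp_weight (β : ℂ) (hβ : 1 < ‖β‖) :
    MemLp (fun θ => (pt θ)⁻¹ * alphaMinus β θ) ∞ mT := by
  have hc : Continuous (fun θ => (pt θ)⁻¹ * alphaMinus β θ) := by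
    refine (continuous_pt.inv₀ fun θ => ?_).mul
      ((continuous_const.mul continuous_pt).div
        ((continuous_const.mul continuous_pt).sub continuous_const)
        (fun θ => den_ne hβ (norm_pt θ)))
    rw [← norm_ne_zero_iff, norm_pt]; exact one_ne_zero
  exact hc.memLp_of_hasCompactSupport (HasCompactSupport.of_compactSpace _)

/-- The weighted shift operator `(J_α f)(t) = t⁻¹ α₋(t) f(α(t))` on `L^p`. -/
def weightedShift (β : ℂ) (hβ : 1 < ‖β‖) : LpT p →L[ℂ] LpT p :=
  mulOp p (fun θ => (pt θ)⁻¹ * alphaMinus β θ) ∘L compShift p β hβ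

lemma integrable_coeFn (f : LpT p) : Integrable f mT :=
  (Lp.memLp f).integrable Fact.out

/-- The Hardy space `H^p`: the functions in `L^p` whose negative Fourier coefficients vanish. -/
def hardy : Submodule ℂ (LpT p) where
  carrier := {f | ∀ n : ℤ, n < 0 → fourierCoeff f n = 0}
  zero_mem' := fun n _ => by
    rw [fourierCoeff_congr_ae (Lp.coeFn_zero ℂ p mT)]
    simp [fourierCoeff]
  add_mem' := fun {f g} hf hg n hn => by
    rw [fourierCoeff_congr_ae (Lp.coeFn_add f g),
      fourierCoeff.add (integrable_coeFn p f) (integrable_coeFn p g), Pi.add_apply,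
      hf n hn, hg n hn, add_zero]
  smul_mem' := fun c f hf n hn => by
    rw [fourierCoeff_congr_ae (Lp.coeFn_smul c f), fourierCoeff.const_smul, hf n hn, smul_zero]

/-- `P` is the analytic projection `∑_{n ∈ ℤ} f_n t^n ↦ ∑_{n ≥ 0} f_n t^n` from `L^p` to `H^p`. -/
def IsRieszProj (P : LpT p →L[ℂ] hardy p) : Prop :=
  ∀ (f : LpT p) (n : ℤ), 0 ≤ n → fourierCoeff ((P f : LpT p)) n = fourierCoeff f n

open scoped Classical in
/-- The analytic projection `P : L^p → H^p`. It exists and is unique for `1 < p < ∞`, the only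
range of exponents in which it is used; the value `0` concerns `p = 1` and `p = ∞` only. -/
def rieszProj : LpT p →L[ℂ] hardy p :=
  if h : ∃ P, IsRieszProj p P then h.choose else 0

/-- `Q = I - P` on `L^p`. -/
def compProj : LpT p →L[ℂ] LpT p :=
  ContinuousLinearMap.id ℂ (LpT p) - (hardy p).subtypeL ∘L rieszProj p

/-- The Toeplitz operator `T(a) f = P (a f)` on `H^p`. -/
def toeplitz (a : Torus → ℂ) : hardy p →L[ℂ] hardy p :=
  rieszProj p ∘L mulOp p a ∘L (hardy p).subtypeL

/-- The generalized Hankel operator `H_α(b) f = P (b Q (J_α f))` on `H^p`. -/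
def hankel (β : ℂ) (hβ : 1 < ‖β‖) (b : Torus → ℂ) : hardy p →L[ℂ] hardy p :=
  rieszProj p ∘L mulOp p b ∘L compProj p ∘L weightedShift p β hβ ∘L (hardy p).subtypeL

end Operators

/-! ### Cokernel and index -/

section Index

variable {X : Type*} [NormedAddCommGroup X] [NormedSpace ℂ X]

/-- The cokernel of `A`, that is, the kernel of the adjoint operator `A* φ = φ ∘ A` on the
dual space. It is trivial if and only if the range of `A` is dense. -/
def coker (A : X →L[ℂ] X) : Submodule ℂ (StrongDual ℂ X) :=
  (ContinuousLinearMap.precomp ℂ A).ker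

lemma mem_coker (A : X →L[ℂ] X) (φ : StrongDual ℂ X) : φ ∈ coker A ↔ φ ∘L A = 0 := Iff.rfl

/-- The index `dim ker A - dim coker A` of a Fredholm operator. -/
def ind (A : X →L[ℂ] X) : ℤ :=
  (Module.finrank ℂ A.ker : ℤ) - (Module.finrank ℂ (coker A) : ℤ)

end Index

/-! ### Matching pairs -/

/-- `a` is an invertible element of `L^∞`. -/
def IsUnitLinfty (a : Torus → ℂ) : Prop :=
  MemLp a ∞ mT ∧ ∃ a' : Torus → ℂ, MemLp a' ∞ mT ∧ ∀ᵐ θ ∂mT, a θ * a' θ = 1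

/-- `(a, b)` is an `α`-matching pair: `a` is invertible in `L^∞`, `b ∈ L^∞`, and
`a(t) a(α(t)) = b(t) b(α(t))` on the unit circle. -/
structure IsMatchingPair (β : ℂ) (hβ : 1 < ‖β‖) (a b : Torus → ℂ) : Prop where
  unit_left : IsUnitLinfty a
  mem_right : MemLp b ∞ mT
  matching : ∀ᵐ θ ∂mT, a θ * a (shift β hβ θ) = b θ * b (shift β hβ θ)

/-- The first function `c = a b⁻¹` of the subordinated pair of `(a, b)`. -/
def subordinated (a b : Torus → ℂ) (θ : Torus) : ℂ := a θ * (b θ)⁻¹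

/-! ### Wiener-Hopf factorization and signature -/

/-- The function `f` belongs to `H^p`. -/
def MemHardy (f : Torus → ℂ) (p : ℝ≥0∞) : Prop :=
  MemLp f p mT ∧ ∀ n : ℤ, n < 0 → fourierCoeff f n = 0

/-- The function `f` belongs to the conjugate Hardy space: it lies in `L^p` and its positive
Fourier coefficients vanish. -/
def MemHardyBar (f : Torus → ℂ) (p : ℝ≥0∞) : Prop :=
  MemLp f p mT ∧ ∀ n : ℤ, 0 < n → fourierCoeff f n = 0

/-- `g = g₋ t^n g₊` is a Wiener-Hopf factorization of `g` in `H^p`. The last condition says that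
`f ↦ g₊⁻¹ P (g₋⁻¹ f)`, defined on the analytic polynomials, is bounded in the norm of `L^p`; in it
`h` is the function `P (g₋⁻¹ f)`, described by its Fourier coefficients. -/
structure IsWienerHopf (p : ℝ≥0∞) (g gm gp : Torus → ℂ) (n : ℤ) : Prop where
  plus_ne : ∀ᵐ θ ∂mT, gp θ ≠ 0
  minus_ne : ∀ᵐ θ ∂mT, gm θ ≠ 0
  factor : ∀ᵐ θ ∂mT, g θ = gm θ * pt θ ^ n * gp θ
  plus_mem : MemHardy gp p.conjExponent
  plus_inv_mem : MemHardy (fun θ => (gp θ)⁻¹) p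
  minus_mem : MemHardyBar gm p
  minus_inv_mem : MemHardyBar (fun θ => (gm θ)⁻¹) p.conjExponent
  /-- `g₋(∞) = 1` -/
  minus_infty : fourierCoeff gm 0 = 1
  bounded : ∃ C : ℝ≥0, ∀ (f : Polynomial ℂ) (h : Torus → ℂ), Integrable h mT →
    (∀ k : ℤ, fourierCoeff h k =
      if 0 ≤ k then fourierCoeff (fun θ => (gm θ)⁻¹ * f.eval (pt θ)) k else 0) →
    eLpNorm (fun θ => (gp θ)⁻¹ * h θ) p mT ≤ C * eLpNorm (fun θ => f.eval (pt θ)) p mT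

/-- The value at the point `z` of the unit disc of the analytic extension of a function from a
Hardy space. -/
def diskValue (f : Torus → ℂ) (z : ℂ) : ℂ := ∑' k : ℕ, fourierCoeff f (k : ℤ) * z ^ k

/-- `ξ = (λ / conj β)^n g₊⁻¹(1 / conj β)`, where `n` is the index of the Toeplitz operator `T(g)` on
`H^p` and `g = g₋ t^{-n} g₊` is the Wiener-Hopf factorization of `g` in `H^p`. -/
def IsSignature (p : ℝ≥0∞) [Fact (1 ≤ p)] (β : ℂ) (g : Torus → ℂ) (ξ : ℂ) : Prop :=
  ∃ gm gp : Torus → ℂ, IsWienerHopf p g gm gp (-ind (toeplitz p g)) ∧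
    ξ = (lam β / conj β) ^ ind (toeplitz p g) * diskValue (fun θ => (gp θ)⁻¹) (1 / conj β)

open scoped Classical in
/-- The `α`-factorization signature of an `α`-matching function `g` with `T(g)` Fredholm on `H^p`.
For such `g` the Wiener-Hopf factorization exists and is unique (almost everywhere), so that
there is exactly one `ξ` with `IsSignature p β g ξ`. -/
def signature (p : ℝ≥0∞) [Fact (1 ≤ p)] (β : ℂ) (g : Torus → ℂ) : ℂ :=
  if h : ∃ ξ, IsSignature p β g ξ then h.choose else 0

end ToeplitzHankel

end

noncomputable section

namespace ToeplitzHankel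

/-! ### Fourier coefficients -/

/-! Write `J` for the weighted shift, `s = ±1` and `T = a + s b J` on `L^p`. `J` is an involution
exchanging `H^p` with `ker P`, so `T(a) + s H_α(b)` is `P T` on `H^p`. With `d = a / b_α`, the
matching condition gives `d J T = s T` and `T J = s T c⁻¹`.

If `f ∈ H^p` is in the kernel, then `T f ∈ ker P`, hence `h = J T f` lies in `H^p` and `d h = s T f
∈ ker P`: `h` is in the kernel of `T(d)`. It is nonzero unless `T f = 0`, that is `c f = -s J f`,
which puts `f` in `ker T(c)`. Dually, a functional `φ` in the cokernel yields `Θ = φ P T c⁻¹`, which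
restricts to an element of `coker T(c)` and satisfies `Θ c J = s Θ`; if `Θ = 0`, then `φ` is in
`coker T(d)`. Coburn's argument (`coburn`) forbids `T(d)` to have both a nontrivial kernel and a
nontrivial cokernel. Thus `ker_eq_bot_or_coker_eq_bot` reduces the claim to excluding two
exceptional objects attached to `T(c)`.

For index `0` Coburn's theorem makes both `ker T(c)` and `coker T(c)` trivial. For index `±1` one of
them is trivial and the other is a line, spanned by `g₊⁻¹` or by integration against `g₋⁻¹`. On this
line `J c`, respectively the adjoint of `c J`, acts as a scalar, which signature `1` makes equal to
`1`; the exceptional object needs the scalar `-1` (`eq_zero_of_ind_eq_one`,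
`eq_zero_of_ind_eq_neg_one`). The link with the signature is that `1 / conj β` is the pole of `α`,
so `J` turns values there into coefficients at infinity (`diskValue_weightedShift`). -/

lemma pt_ne_zero (θ : Torus) : pt θ ≠ 0 := by
  rw [← norm_ne_zero_iff, norm_pt]; exact one_ne_zero

lemma fourier_eq_pt_zpow (n : ℤ) (θ : Torus) : fourier n θ = pt θ ^ n := by
  rw [fourier_apply, toCircle_zsmul, Circle.coe_zpow]; rfl

lemma fourierCoeff_eq (f : Torus → ℂ) (n : ℤ) :
    fourierCoeff f n = ∫ θ, pt θ ^ (-n) * f θ ∂mT := by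
  simp only [fourierCoeff, fourier_eq_pt_zpow, smul_eq_mul]

lemma norm_fourierCoeff_le (f : Torus → ℂ) (n : ℤ) :
    ‖fourierCoeff f n‖ ≤ ∫ θ, ‖f θ‖ ∂mT := by
  rw [fourierCoeff_eq]
  refine (norm_integral_le_integral_norm _).trans_eq ?_
  simp [norm_pt]

lemma fourierCoeff_zpow_mul (f : Torus → ℂ) (m n : ℤ) :
    fourierCoeff (fun θ => pt θ ^ m * f θ) n = fourierCoeff f (n - m) := by
  rw [fourierCoeff_eq, fourierCoeff_eq]
  congr 1
  ext θ
  rw [← mul_assoc, ← zpow_add₀ (pt_ne_zero θ)]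
  ring_nf

lemma fourierCoeff_pt_mul (f : Torus → ℂ) (n : ℤ) :
    fourierCoeff (fun θ => pt θ * f θ) n = fourierCoeff f (n - 1) := by
  simpa using fourierCoeff_zpow_mul f 1 n

lemma continuous_pt_zpow (n : ℤ) : Continuous (fun θ => pt θ ^ n) :=
  continuous_pt.zpow₀ n fun θ => Or.inl (pt_ne_zero θ)

lemma memLp_of_continuous {f : Torus → ℂ} (hf : Continuous f) (p : ℝ≥0∞) : MemLp f p mT :=
  hf.memLp_of_hasCompactSupport (HasCompactSupport.of_compactSpace _)

lemma fourierCoeff_add' {f g : Torus → ℂ} (hf : Integrable f mT) (hg : Integrable g mT) (n : ℤ) :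
    fourierCoeff (fun θ => f θ + g θ) n = fourierCoeff f n + fourierCoeff g n :=
  congrFun (fourierCoeff.add hf hg) n

lemma fourierCoeff_sub' {f g : Torus → ℂ} (hf : Integrable f mT) (hg : Integrable g mT) (n : ℤ) :
    fourierCoeff (fun θ => f θ - g θ) n = fourierCoeff f n - fourierCoeff g n := by
  have h := fourierCoeff_add' hf (hg.const_mul (-1)) n
  rw [fourierCoeff.const_mul] at h
  simpa [sub_eq_add_neg] using h

lemma integrable_pt_mul {f : Torus → ℂ} (hf : Integrable f mT) :
    Integrable (fun θ => pt θ * f θ) mT :=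
  hf.bdd_mul (c := 1) continuous_pt.aestronglyMeasurable
    (Filter.Eventually.of_forall fun θ => (norm_pt θ).le)

lemma fourierCoeff_linear_mul {f : Torus → ℂ} (hf : Integrable f mT) (x y : ℂ) (n : ℤ) :
    fourierCoeff (fun θ => (x * pt θ - y) * f θ) n =
      x * fourierCoeff f (n - 1) - y * fourierCoeff f n := by
  have h := fourierCoeff_sub' ((integrable_pt_mul hf).const_mul x) (hf.const_mul y) n
  rw [fourierCoeff.const_mul, fourierCoeff.const_mul, fourierCoeff_pt_mul] at h
  rw [← h]
  congr 1
  ext θ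
  ring

lemma fourierCoeff_pt_zpow (m n : ℤ) :
    fourierCoeff (fun θ => pt θ ^ m) n = if n = m then 1 else 0 := by
  have h := fourierCoeff_fourier (T := 2 * Real.pi) m
  have e : (fun θ : Torus => pt θ ^ m) = fourier m := by
    ext θ; rw [fourier_eq_pt_zpow]
  rw [e, h]
  simp [Pi.single_apply]

lemma fourierCoeff_one (n : ℤ) :
    fourierCoeff (fun _ : Torus => (1 : ℂ)) n = if n = 0 then 1 else 0 := by
  simpa using fourierCoeff_pt_zpow 0 n

/-- A bounded geometric sequence with ratio outside the closed unit disc vanishes. -/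
lemma eq_zero_of_geometric_of_bounded {u : ℕ → ℂ} {z : ℂ} {C : ℝ} (hz : 1 < ‖z‖)
    (hu : ∀ k, u (k + 1) = z * u k) (hC : ∀ k, ‖u k‖ ≤ C) (k : ℕ) : u k = 0 := by
  have key : u 0 = 0 := by
    by_contra h0
    have hpow : ∀ k, u k = z ^ k * u 0 := by
      intro k
      induction k with
      | zero => simp
      | succ k ih => rw [hu, ih]; ring
    obtain ⟨k, hk⟩ := pow_unbounded_of_one_lt (C / ‖u 0‖) hz
    have h1 := hC k
    rw [hpow, norm_mul, norm_pow] at h1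
    rw [div_lt_iff₀ (norm_pos_iff.mpr h0)] at hk
    linarith
  induction k with
  | zero => exact key
  | succ k ih => rw [hu, ih, mul_zero]

/-! ### Multiplication operators -/

section Mul

variable (p : ℝ≥0∞) [Fact (1 ≤ p)]

lemma memLp_top_mul {a b : Torus → ℂ} (ha : MemLp a ∞ mT) (hb : MemLp b ∞ mT) :
    MemLp (fun θ => a θ * b θ) ∞ mT := hb.mul ha

lemma mulOp_mulOp {a b : Torus → ℂ} (ha : MemLp a ∞ mT) (hb : MemLp b ∞ mT) (f : LpT p) :
    mulOp p a (mulOp p b f) = mulOp p (fun θ => a θ * b θ) f := by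
  apply Lp.ext
  filter_upwards [coeFn_mulOp p ha (mulOp p b f), coeFn_mulOp p hb f,
    coeFn_mulOp p (memLp_top_mul ha hb) f] with θ h1 h2 h3
  rw [h1, h2, h3, mul_assoc]

lemma coeFn_weightedShift (β : ℂ) (hβ : 1 < ‖β‖) (f : LpT p) :
    weightedShift p β hβ f =ᵐ[mT]
      fun θ => lam β / (conj β * pt θ - 1) * f (shift β hβ θ) := by
  filter_upwards [coeFn_mulOp p (memLp_weight β hβ) (compShift p β hβ f),
    coeFn_compShift p β hβ f] with θ h1 h2
  rw [weightedShift, ContinuousLinearMap.comp_apply, h1, h2, alphaMinus]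
  have := pt_ne_zero θ
  have := den_ne hβ (norm_pt θ)
  field_simp

lemma lam_sq (β : ℂ) (hβ : 1 < ‖β‖) : lam β * lam β = 1 - conj β * β := by
  have h : (Real.sqrt (‖β‖ ^ 2 - 1) : ℂ) * Real.sqrt (‖β‖ ^ 2 - 1) = ‖β‖ ^ 2 - 1 := by
    rw [← Complex.ofReal_mul, Real.mul_self_sqrt (by nlinarith)]
    push_cast; ring
  have h2 : conj β * β = (‖β‖ : ℂ) ^ 2 := by
    rw [mul_comm, Complex.mul_conj, Complex.normSq_eq_norm_sq]; push_cast; ring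
  rw [h2, lam]
  linear_combination (Real.sqrt (‖β‖ ^ 2 - 1) : ℂ) * Real.sqrt (‖β‖ ^ 2 - 1) * Complex.I_mul_I - h

lemma lam_ne_zero (β : ℂ) (hβ : 1 < ‖β‖) : lam β ≠ 0 := by
  have : 0 < ‖β‖ ^ 2 - 1 := by nlinarith
  simp [lam, (Real.sqrt_pos.mpr this).ne']

/-- This identity is what `λ` is chosen for: the weight `λ / (conj β t - 1)` times its own shift is
`1`, which makes `J_α` an involution. -/
lemma den_mul_den (β : ℂ) (hβ : 1 < ‖β‖) (θ : Torus) :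
    (conj β * pt (shift β hβ θ) - 1) * (conj β * pt θ - 1) = lam β * lam β := by
  have h1 := den_ne hβ (norm_pt θ)
  have h3 : moebius β (pt θ) * (conj β * pt θ - 1) = pt θ - β := div_mul_cancel₀ _ h1
  rw [pt_shift, lam_sq β hβ]
  linear_combination conj β * h3

lemma weightedShift_weightedShift (β : ℂ) (hβ : 1 < ‖β‖) (f : LpT p) :
    weightedShift p β hβ (weightedShift p β hβ f) = f := by
  apply Lp.ext
  filter_upwards [coeFn_weightedShift p β hβ (weightedShift p β hβ f),
    (quasi_shift β hβ).ae (coeFn_weightedShift p β hβ f)] with θ h1 h2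
  rw [h1, h2, shift_shift, ← mul_assoc, div_mul_div_comm, mul_comm (conj β * pt θ - 1),
    den_mul_den, div_self (mul_self_ne_zero.mpr (lam_ne_zero β hβ)), one_mul]

lemma memLp_top_shift (β : ℂ) (hβ : 1 < ‖β‖) {a : Torus → ℂ} (ha : MemLp a ∞ mT) :
    MemLp (fun θ => a (shift β hβ θ)) ∞ mT := memLp_comp_shift β hβ ha

lemma weightedShift_mulOp (β : ℂ) (hβ : 1 < ‖β‖) {a : Torus → ℂ} (ha : MemLp a ∞ mT)
    (f : LpT p) :
    weightedShift p β hβ (mulOp p a f) =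
      mulOp p (fun θ => a (shift β hβ θ)) (weightedShift p β hβ f) := by
  apply Lp.ext
  filter_upwards [coeFn_weightedShift p β hβ (mulOp p a f), coeFn_weightedShift p β hβ f,
    coeFn_mulOp p (memLp_top_shift β hβ ha) (weightedShift p β hβ f),
    (quasi_shift β hβ).ae (coeFn_mulOp p ha f)] with θ h1 h2 h3 h4
  rw [h1, h3, h2, h4]
  ring

end Mul

/-! ### Density and uniqueness -/

section Density

variable {p : ℝ≥0∞} [Fact (1 ≤ p)]

/-- Approximating by multiples `g F` in `L^p` becomes approximating by `g` in the weighted space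
`L^p(|F|^p)`, where continuous functions are dense. -/
lemma eLpNorm_withDensity_rpow (hp : p ≠ ∞) {F H : Torus → ℂ} (hF : AEMeasurable F mT)
    (hH : AEMeasurable H mT) :
    eLpNorm H p (mT.withDensity fun θ => ‖F θ‖ₑ ^ p.toReal) =
      eLpNorm (fun θ => H θ * F θ) p mT := by
  have hp0 : p ≠ 0 := (zero_lt_one.trans_le (Fact.out : 1 ≤ p)).ne'
  rw [eLpNorm_eq_lintegral_rpow_enorm_toReal hp0 hp, eLpNorm_eq_lintegral_rpow_enorm_toReal hp0 hp,
    lintegral_withDensity_eq_lintegral_mul₀ (by fun_prop) (by fun_prop)]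
  congr 2
  ext θ
  simp only [Pi.mul_apply]
  rw [enorm_mul, ENNReal.mul_rpow_of_nonneg _ _ ENNReal.toReal_nonneg, mul_comm]

/-- The functional `f ↦ ∫ G f` on `L^p`, for `G ∈ L^q` with the conjugate exponent `q`. -/
def pairing {q : ℝ≥0∞} [hq : q.HolderConjugate p] {G : Torus → ℂ} (hG : MemLp G q mT) :
    LpT p →L[ℂ] ℂ :=
  haveI : Fact (1 ≤ q) := ⟨ENNReal.HolderConjugate.one_le q p⟩
  (ContinuousLinearMap.mul ℂ ℂ).lpPairing mT q p hG.toLp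

lemma pairing_apply {q : ℝ≥0∞} [hq : q.HolderConjugate p] {G : Torus → ℂ} (hG : MemLp G q mT)
    (f : LpT p) : pairing hG f = ∫ θ, G θ * f θ ∂mT := by
  rw [pairing, ContinuousLinearMap.lpPairing_eq_integral]
  refine integral_congr_ae ?_
  filter_upwards [hG.coeFn_toLp] with θ hθ
  rw [hθ]
  rfl

/-- The multiples of `F` by continuous functions are dense among the functions in `L^p`
supported in the support of `F`. -/
lemma exists_continuous_mul_approx (hp : p ≠ ∞) {F G : Torus → ℂ} (hF : MemLp F p mT)
    (hG : MemLp G p mT) (h : ∀ᵐ θ ∂mT, F θ = 0 → G θ = 0) {ε : ℝ≥0∞} (hε : ε ≠ 0) :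
    ∃ g : C(Torus, ℂ), eLpNorm (fun θ => G θ - g θ * F θ) p mT ≤ ε := by
  have hp0 : p ≠ 0 := (zero_lt_one.trans_le (Fact.out : 1 ≤ p)).ne'
  set ν := mT.withDensity fun θ => ‖F θ‖ₑ ^ p.toReal with hν
  have hFm := hF.1.aemeasurable
  have hGm := hG.1.aemeasurable
  have hac : ν ≪ mT := withDensity_absolutelyContinuous _ _
  have hfin : IsFiniteMeasure ν := by
    apply isFiniteMeasure_withDensity
    exact (lintegral_rpow_enorm_lt_top_of_eLpNorm_lt_top hp0 hp hF.2).ne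
  have hq : AEMeasurable (fun θ => G θ / F θ) mT := hGm.div hFm
  have hmem : MemLp (fun θ => G θ / F θ) p ν := by
    refine ⟨(hq.mono_ac hac).aestronglyMeasurable, ?_⟩
    rw [hν, eLpNorm_withDensity_rpow hp hFm hq]
    refine (eLpNorm_congr_ae ?_).trans_lt hG.2
    filter_upwards [h] with θ hθ
    by_cases h0 : F θ = 0
    · rw [h0, hθ h0]; simp
    · exact div_mul_cancel₀ _ h0
  obtain ⟨g, hg, -⟩ := hmem.exists_boundedContinuous_eLpNorm_sub_le hp hε
  refine ⟨g.toContinuousMap, ?_⟩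
  have hgm : AEMeasurable (fun θ => g θ) mT := g.continuous.measurable.aemeasurable
  have e := eLpNorm_withDensity_rpow hp hFm (hq.sub hgm)
  refine le_trans (le_of_eq ?_) hg
  refine Eq.trans (eLpNorm_congr_ae ?_) e.symm
  filter_upwards [h] with θ hθ
  simp only [Pi.sub_apply]
  by_cases h0 : F θ = 0
  · rw [h0, hθ h0]; simp
  · rw [sub_mul, div_mul_cancel₀ _ h0]; rfl

/-- The map `g ↦ g F` from continuous functions to `L^p`. -/
def continuousMul (F : LpT p) : C(Torus, ℂ) →L[ℂ] LpT p :=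
  ((ContinuousLinearMap.mul ℂ ℂ).holderL mT ∞ p p).flip F ∘L ContinuousMap.toLp ∞ mT ℂ

lemma coeFn_continuousMul (F : LpT p) (g : C(Torus, ℂ)) :
    continuousMul F g =ᵐ[mT] fun θ => g θ * F θ := by
  have h := (ContinuousLinearMap.mul ℂ ℂ).coeFn_holder (r := p)
    (ContinuousMap.toLp ∞ mT ℂ g) F
  filter_upwards [h, ContinuousMap.coeFn_toLp (p := ∞) (𝕜 := ℂ) mT g] with θ h1 h2
  rw [h2] at h1
  exact h1

/-- Trigonometric polynomials are uniformly dense in the continuous functions, so the multiples `t^n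
F` already span a space whose closure contains every `G` that vanishes where `F` does. -/
lemma eq_zero_of_continuousMul_fourier {E : Type*} [NormedAddCommGroup E] [NormedSpace ℂ E]
    (hp : p ≠ ∞) (Φ : LpT p →L[ℂ] E) {F G : LpT p}
    (h : ∀ᵐ θ ∂mT, F θ = 0 → G θ = 0) (hΦ : ∀ n : ℤ, Φ (continuousMul F (fourier n)) = 0) :
    Φ G = 0 := by
  have h1 : Φ ∘L continuousMul F = 0 := by
    refine ContinuousLinearMap.ext_on (s := Set.range (fourier (T := 2 * Real.pi))) ?_ ?_
    · rw [Submodule.dense_iff_topologicalClosure_eq_top]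
      exact span_fourier_closure_eq_top
    · rintro _ ⟨n, rfl⟩
      exact hΦ n
  have hcl : G ∈ closure (Set.range (continuousMul F)) := by
    rw [EMetric.mem_closure_iff]
    intro ε hε
    obtain ⟨δ, hδ0, hδ⟩ := exists_between hε
    obtain ⟨g, hg⟩ := exists_continuous_mul_approx hp (Lp.memLp F) (Lp.memLp G) h hδ0.ne'
    refine ⟨_, ⟨g, rfl⟩, ?_⟩
    rw [Lp.edist_def]
    refine lt_of_le_of_lt (le_of_eq_of_le (eLpNorm_congr_ae ?_) hg) hδ
    filter_upwards [coeFn_continuousMul F g] with θ hθ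
    rw [Pi.sub_apply, hθ]
  have hclosed : IsClosed {x | Φ x = 0} := isClosed_eq Φ.continuous continuous_const
  refine closure_minimal ?_ hclosed hcl
  rintro _ ⟨g, rfl⟩
  exact DFunLike.congr_fun h1 g

/-- Uniqueness of Fourier coefficients. -/
lemma ae_eq_zero_of_fourierCoeff {f : Torus → ℂ} (hf : Integrable f mT)
    (h : ∀ n, fourierCoeff f n = 0) : f =ᵐ[mT] 0 := by
  have hf1 : MemLp f 1 mT := memLp_one_iff_integrable.mpr hf
  have hn1 : MemLp (fun θ => (‖f θ‖ : ℂ)) 1 mT := hf1.norm.ofReal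
  have hone : MemLp (fun _ : Torus => (1 : ℂ)) ∞ mT := memLp_top_const 1
  -- The functional is the integral, `F = f` and `G = |f|`: since every `∫ t^n f` is zero, so is `∫
  -- |f|`.
  have key := eq_zero_of_continuousMul_fourier ENNReal.one_ne_top (pairing hone)
    (F := hf1.toLp) (G := hn1.toLp) ?_ ?_
  · rw [pairing_apply] at key
    have e : ∫ θ, (‖f θ‖ : ℂ) ∂mT = 0 := by
      rw [← key]
      refine integral_congr_ae ?_
      filter_upwards [hn1.coeFn_toLp] with θ hθ
      rw [hθ, one_mul]
    have e2 : ∫ θ, ‖f θ‖ ∂mT = 0 := by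
      rw [integral_complex_ofReal] at e
      exact_mod_cast e
    rw [integral_eq_zero_iff_of_nonneg (fun _ => norm_nonneg _) hf.norm] at e2
    filter_upwards [e2] with θ hθ
    exact norm_eq_zero.mp hθ
  · filter_upwards [hf1.coeFn_toLp, hn1.coeFn_toLp] with θ h1 h2 h0
    rw [h1] at h0
    rw [h2, h0]
    simp
  · intro n
    rw [pairing_apply, ← h (-n), fourierCoeff]
    refine integral_congr_ae ?_
    filter_upwards [coeFn_continuousMul hf1.toLp (fourier n), hf1.coeFn_toLp] with θ h1 h2
    rw [h1, h2, neg_neg, smul_eq_mul, one_mul]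

lemma Lp_ext_fourierCoeff {f g : LpT p} (h : ∀ n, fourierCoeff f n = fourierCoeff g n) :
    f = g := by
  have hf := integrable_coeFn p f
  have hg := integrable_coeFn p g
  have := ae_eq_zero_of_fourierCoeff (hf.sub hg) fun n => by
    have e := fourierCoeff_sub' hf hg n
    rw [h, sub_self] at e
    exact e
  apply Lp.ext
  filter_upwards [this] with θ hθ
  exact sub_eq_zero.mp hθ

end Density

/-! ### Jensen's inequality and boundary zeros of analytic functions -/

lemma integrable_haar_of_intervalIntegrable {f : Torus → ℝ} (hf : Measurable f)
    (h : IntervalIntegrable (fun x : ℝ => f x) volume 0 (2 * Real.pi)) : Integrable f mT := by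
  have hT := Real.two_pi_pos
  have hmp := AddCircle.measurePreserving_mk (2 * Real.pi) 0
  rw [zero_add] at hmp
  rw [intervalIntegrable_iff_integrableOn_Ioc_of_le hT.le] at h
  have h1 : Integrable f (volume : Measure Torus) :=
    (hmp.integrable_comp hf.aestronglyMeasurable).mp h
  rw [volume_eq_smul_haarAddCircle, integrable_smul_measure (by simpa using Real.pi_pos)
    ENNReal.ofReal_ne_top] at h1
  exact h1

lemma integral_mT (f : Torus → ℝ) :
    ∫ θ, f θ ∂mT = (2 * Real.pi)⁻¹ * ∫ x in (0 : ℝ)..(2 * Real.pi), f x := by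
  have h := AddCircle.intervalIntegral_preimage (2 * Real.pi) 0 f
  rw [zero_add] at h
  rw [h, volume_eq_smul_haarAddCircle, integral_smul_measure,
    ENNReal.toReal_ofReal Real.two_pi_pos.le, smul_eq_mul,
    inv_mul_cancel_left₀ Real.two_pi_pos.ne']

lemma pt_coe (x : ℝ) : pt (x : Torus) = circleMap 0 1 x := by
  have hpi : 2 * Real.pi ≠ 0 := Real.two_pi_pos.ne'
  simp [pt, toCircle_apply_mk, Circle.coe_exp, circleMap]

lemma integrable_log_polynomial (q : Polynomial ℂ) :
    Integrable (fun θ => Real.log ‖q.eval (pt θ)‖) mT := by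
  apply integrable_haar_of_intervalIntegrable
  · have : Measurable (fun θ => q.eval (pt θ)) := (q.continuous.comp continuous_pt).measurable
    fun_prop
  · simp only [pt_coe]
    exact q.intervalIntegrable_mahlerMeasure

/-- Jensen's inequality, obtained from the bound of the constant coefficient by the Mahler measure.
-/
lemma log_norm_eval_zero_le (q : Polynomial ℂ) (h0 : q.eval 0 ≠ 0) :
    Real.log ‖q.eval 0‖ ≤ ∫ θ, Real.log ‖q.eval (pt θ)‖ ∂mT := by
  have hq : q ≠ 0 := by rintro rfl; simp at h0
  have h1 := q.norm_coeff_le_choose_mul_mahlerMeasure 0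
  rw [Nat.choose_zero_right, Nat.cast_one, one_mul, Polynomial.coeff_zero_eq_eval_zero,
    Polynomial.mahlerMeasure_def_of_ne_zero hq] at h1
  have h2 := (Real.log_le_iff_le_exp (norm_pos_iff.mpr h0)).mpr h1
  rw [integral_mT]
  simp only [pt_coe]
  exact h2

lemma ae_eval_pt_ne_zero (q : Polynomial ℂ) (hq : q ≠ 0) : ∀ᵐ θ ∂mT, q.eval (pt θ) ≠ 0 := by
  have hfin : Set.Finite {θ : Torus | q.eval (pt θ) = 0} := by
    have : {θ : Torus | q.eval (pt θ) = 0} = pt ⁻¹' {z | q.IsRoot z} := rfl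
    rw [this]
    exact (Polynomial.finite_setOfPred_isRoot hq).preimage pt_injective.injOn
  have : Nontrivial Torus := by
    refine ⟨(0 : ℝ), Real.pi, fun h => ?_⟩
    have h2 := congrArg pt h
    rw [pt_coe, pt_coe] at h2
    norm_num [circleMap, Complex.exp_pi_mul_I] at h2
  have : (nhdsWithin (0 : Torus) {0}ᶜ).NeBot := inferInstance
  have hz : mT {θ : Torus | q.eval (pt θ) = 0} = 0 := hfin.measure_zero mT
  rw [ae_iff]
  simpa using hz

lemma fourierCoeff_polynomial (q : Polynomial ℂ) :
    fourierCoeff (fun θ => q.eval (pt θ)) 0 = q.eval 0 := by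
  induction q using Polynomial.induction_on' with
  | add q r hq hr =>
    simp only [Polynomial.eval_add]
    rw [fourierCoeff_add', hq, hr]
    · exact (memLp_of_continuous (q.continuous.comp continuous_pt) 1).integrable le_rfl
    · exact (memLp_of_continuous (r.continuous.comp continuous_pt) 1).integrable le_rfl
  | monomial n a =>
    simp only [Polynomial.eval_monomial]
    rw [fourierCoeff.const_mul]
    have := fourierCoeff_pt_zpow n 0
    simp only [zpow_natCast] at this
    rw [this]
    rcases eq_or_ne n 0 with rfl | hn
    · simp
    · simp [hn, eq_comm (a := (0 : ℤ))]

/-- Jensen's inequality with `log |q|` estimated separately on `E` and off it. On `E` one has `|q| =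
|g - q|` and `log |q| ≤ |q| / ε + log ε`; elsewhere `log |q| ≤ |q| ≤ |g| + |g - q|`. If `E` has
positive measure, a small `ε` makes the right side very negative while `q` stays close to `g`. -/
lemma integral_log_le {g : Torus → ℂ} (hg : Integrable g mT) (q : Polynomial ℂ)
    (h0 : q.eval 0 ≠ 0) {E : Set Torus} (hE : MeasurableSet E) (hgE : ∀ θ ∈ E, g θ = 0)
    {ε : ℝ} (hε : 0 < ε) :
    Real.log ‖q.eval 0‖ ≤ (∫ θ, ‖g θ - q.eval (pt θ)‖ ∂mT) / ε + mT.real E * Real.log ε +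
      ((∫ θ, ‖g θ‖ ∂mT) + ∫ θ, ‖g θ - q.eval (pt θ)‖ ∂mT) := by
  have hq : q ≠ 0 := by rintro rfl; simp at h0
  have hqi : Integrable (fun θ => q.eval (pt θ)) mT :=
    (memLp_of_continuous (q.continuous.comp continuous_pt) 1).integrable le_rfl
  have hd := (hg.sub hqi).norm
  simp only [Pi.sub_apply] at hd
  have hi : Integrable (E.indicator fun _ : Torus => Real.log ε) mT :=
    (integrable_const _).indicator hE
  have hle : ∫ θ, Real.log ‖q.eval (pt θ)‖ ∂mT ≤ ∫ θ, (‖g θ - q.eval (pt θ)‖ / ε +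
      E.indicator (fun _ => Real.log ε) θ + (‖g θ‖ + ‖g θ - q.eval (pt θ)‖)) ∂mT := by
    refine integral_mono_ae (integrable_log_polynomial q)
      (((hd.div_const ε).add hi).add (hg.norm.add hd)) ?_
    filter_upwards [ae_eval_pt_ne_zero q hq] with θ hθ
    have hpos := norm_pos_iff.mpr hθ
    by_cases hE' : θ ∈ E
    · rw [Set.indicator_of_mem hE', hgE θ hE']
      have h1 := Real.log_le_sub_one_of_pos (div_pos hpos hε)
      rw [Real.log_div hpos.ne' hε.ne'] at h1
      simp only [zero_sub, norm_neg, norm_zero]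
      linarith
    · rw [Set.indicator_of_notMem hE']
      have h1 := Real.log_le_sub_one_of_pos hpos
      have h2 : ‖q.eval (pt θ)‖ ≤ ‖g θ‖ + ‖g θ - q.eval (pt θ)‖ := by
        rw [add_comm, norm_sub_rev]
        have := norm_add_le (q.eval (pt θ) - g θ) (g θ)
        rwa [sub_add_cancel] at this
      have h3 : 0 ≤ ‖g θ - q.eval (pt θ)‖ / ε := by positivity
      linarith
  refine (log_norm_eval_zero_le q h0).trans (hle.trans_eq ?_)
  have e1 := integral_add ((hd.div_const ε).add hi) (hg.norm.add hd)
  simp only [Pi.add_apply] at e1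
  rw [e1, integral_add (hd.div_const ε) hi, integral_add hg.norm hd, integral_div, integral_indicator_const _ hE, smul_eq_mul]

/-- A limit in `L^1` of analytic polynomials whose mean is not zero vanishes almost nowhere. -/
lemma ae_ne_zero_of_polynomial_approx {g : Torus → ℂ} (hg : Integrable g mT)
    (happ : ∀ η > 0, ∃ q : Polynomial ℂ, ∫ θ, ‖g θ - q.eval (pt θ)‖ ∂mT ≤ η)
    (h0 : fourierCoeff g 0 ≠ 0) : ∀ᵐ θ ∂mT, g θ ≠ 0 := by
  obtain ⟨g', hg'm, hgg'⟩ := hg.1.aemeasurable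
  set E : Set Torus := {θ | g' θ = 0} with hE
  have hEm : MeasurableSet E := hg'm (measurableSet_singleton 0)
  suffices hz : mT.real E = 0 by
    have hz' : mT E = 0 := (measureReal_eq_zero_iff).mp hz
    have : ∀ᵐ θ ∂mT, g' θ ≠ 0 := by rw [ae_iff]; simpa using hz'
    filter_upwards [this, hgg'] with θ h1 h2
    rwa [h2]
  by_contra hne
  have hδ : 0 < mT.real E := lt_of_le_of_ne measureReal_nonneg (Ne.symm hne)
  have hg'i : Integrable g' mT := hg.congr hgg'
  set c := ‖fourierCoeff g 0‖ with hc
  have hcpos : 0 < c := norm_pos_iff.mpr h0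
  set N := ∫ θ, ‖g' θ‖ ∂mT
  -- With this `ε` the term `mT.real E * log ε` equals `log (c / 2) - N - 3`. The other terms add up
  -- to at most `N + 2`, so the upper bound falls below `log (c / 2) ≤ log |q(0)|`.
  set ε := Real.exp ((Real.log (c / 2) - N - 3) / mT.real E) with hεd
  have hε : 0 < ε := Real.exp_pos _
  obtain ⟨q, hq⟩ := happ (min ε (min 1 (c / 2))) (by positivity)
  have hqi : Integrable (fun θ => q.eval (pt θ)) mT :=
    (memLp_of_continuous (q.continuous.comp continuous_pt) 1).integrable le_rfl
  have heq : ∫ θ, ‖g' θ - q.eval (pt θ)‖ ∂mT = ∫ θ, ‖g θ - q.eval (pt θ)‖ ∂mT := by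
    refine integral_congr_ae ?_
    filter_upwards [hgg'] with θ hθ
    rw [hθ]
  set η := ∫ θ, ‖g θ - q.eval (pt θ)‖ ∂mT
  have hη1 : η ≤ ε := hq.trans (min_le_left _ _)
  have hη2 : η ≤ 1 := hq.trans ((min_le_right _ _).trans (min_le_left _ _))
  have hη3 : η ≤ c / 2 := hq.trans ((min_le_right _ _).trans (min_le_right _ _))
  have hcoef : ‖fourierCoeff g 0 - q.eval 0‖ ≤ η := by
    rw [← fourierCoeff_polynomial, ← fourierCoeff_sub' hg hqi]
    exact norm_fourierCoeff_le _ _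
  have hq0 : c / 2 ≤ ‖q.eval 0‖ := by
    have := norm_sub_norm_le (fourierCoeff g 0) (q.eval 0)
    linarith
  have hq0' : q.eval 0 ≠ 0 := norm_pos_iff.mp (by linarith)
  have key := integral_log_le hg'i q hq0' hEm (fun θ hθ => hθ) hε
  rw [heq] at key
  have hlog : mT.real E * Real.log ε = Real.log (c / 2) - N - 3 := by
    rw [hεd, Real.log_exp, mul_div_cancel₀ _ hδ.ne']
  have h1 : η / ε ≤ 1 := (div_le_one hε).mpr hη1
  have h2 : Real.log (c / 2) ≤ Real.log ‖q.eval 0‖ := Real.log_le_log (by positivity) hq0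
  rw [hlog] at key
  linarith

/-! ### Hardy spaces -/

section Hardy

variable {p : ℝ≥0∞} [Fact (1 ≤ p)]

lemma coeFn_fourierLp' (n : ℤ) : (fourierLp p n : LpT p) =ᵐ[mT] fun θ => pt θ ^ n := by
  filter_upwards [coeFn_fourierLp (T := 2 * Real.pi) p n] with θ hθ
  rw [hθ, fourier_eq_pt_zpow]

lemma fourierCoeff_fourierLp (m n : ℤ) :
    fourierCoeff (fourierLp p m : LpT p) n = if n = m then 1 else 0 := by
  rw [fourierCoeff_congr_ae (coeFn_fourierLp' m), fourierCoeff_pt_zpow]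

lemma fourierLp_mem_hardy {n : ℤ} (hn : 0 ≤ n) : (fourierLp p n : LpT p) ∈ hardy p := by
  intro k hk
  rw [fourierCoeff_fourierLp, if_neg (by omega)]

lemma infinite_dimensional_hardy : ¬ FiniteDimensional ℂ (hardy p) := by
  intro h
  let v : ℕ → hardy p := fun n => ⟨fourierLp p (n : ℤ), fourierLp_mem_hardy (by positivity)⟩
  have hv : LinearIndependent ℂ v := by
    rw [linearIndependent_iff']
    intro s g hg i hi
    have h1 : ((∑ j ∈ s, g j • v j : hardy p) : LpT p) = 0 := by rw [hg]; rfl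
    let L : LpT p →+ ℂ :=
      { toFun := fun f => fourierCoeff f (i : ℤ)
        map_zero' := by
          rw [fourierCoeff_congr_ae (Lp.coeFn_zero ℂ p mT)]
          simp [fourierCoeff]
        map_add' := fun f g => by
          rw [fourierCoeff_congr_ae (Lp.coeFn_add f g),
            fourierCoeff.add (integrable_coeFn p f) (integrable_coeFn p g), Pi.add_apply] }
    have hL : ∀ j, L (g j • (v j : LpT p)) = if i = j then g j else 0 := by
      intro j
      change fourierCoeff (g j • (fourierLp p (j : ℤ) : LpT p) : LpT p) (i : ℤ) = _
      rw [fourierCoeff_congr_ae (Lp.coeFn_smul _ _), fourierCoeff.const_smul,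
        fourierCoeff_fourierLp]
      simp
    have h2 := congrArg L h1
    rw [Submodule.coe_sum, map_sum, map_zero] at h2
    simp only [Submodule.coe_smul, hL] at h2
    simpa [hi] using h2
  exact not_finite_iff_infinite.mpr (inferInstanceAs (Infinite ℕ)) hv.finite

/-- A Fredholm Toeplitz operator presupposes the analytic projection. -/
lemma isRieszProj_of_isFredholm {c : Torus → ℂ} (hc : (toeplitz p c).IsFredholm) :
    IsRieszProj p (rieszProj p) := by
  by_cases h : ∃ P, IsRieszProj p P
  · rw [rieszProj, dif_pos h]
    exact h.choose_spec
  · exfalso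
    -- The default value would make the Toeplitz operator zero, with all of the infinite-dimensional
    -- `H^p` as its kernel.
    have h0 : rieszProj p = 0 := dif_neg h
    have h1 : toeplitz p c = 0 := by rw [toeplitz, h0, ContinuousLinearMap.zero_comp]
    have h2 := hc.finite_ker
    rw [h1] at h2
    apply infinite_dimensional_hardy (p := p)
    have h3 : (0 : hardy p →L[ℂ] hardy p).ker = ⊤ := LinearMap.ker_zero
    rw [h3] at h2
    exact Module.Finite.of_surjective (⊤ : Submodule ℂ (hardy p)).subtype
      (fun x => ⟨⟨x, trivial⟩, rfl⟩)

variable (hP : IsRieszProj p (rieszProj p))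
include hP

lemma rieszProj_of_mem {f : LpT p} (hf : f ∈ hardy p) : (rieszProj p f : LpT p) = f := by
  apply Lp_ext_fourierCoeff
  intro n
  rcases lt_or_ge n 0 with hn | hn
  · rw [hf n hn]
    exact (rieszProj p f).2 n hn
  · exact hP f n hn

lemma rieszProj_eq_zero_iff {f : LpT p} :
    rieszProj p f = 0 ↔ ∀ n : ℤ, 0 ≤ n → fourierCoeff f n = 0 := by
  have h0 : ∀ n, fourierCoeff (0 : LpT p) n = 0 := fun n => by
    rw [fourierCoeff_congr_ae (Lp.coeFn_zero ℂ p mT)]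
    simp [fourierCoeff]
  constructor
  · intro h n hn
    rw [← hP f n hn, h]
    exact h0 n
  · intro h
    apply Subtype.ext
    apply Lp_ext_fourierCoeff
    intro n
    rw [Submodule.coe_zero, h0]
    rcases lt_or_ge n 0 with hn | hn
    · exact (rieszProj p f).2 n hn
    · rw [hP f n hn, h n hn]

omit hP in
lemma clm_eq_zero_of_fourierLp {E : Type*} [NormedAddCommGroup E] [NormedSpace ℂ E]
    (hp : p ≠ ∞) (Φ : LpT p →L[ℂ] E) (h : ∀ n : ℤ, Φ (fourierLp p n) = 0) : Φ = 0 := by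
  refine ContinuousLinearMap.ext_on (s := Set.range (fourierLp (T := 2 * Real.pi) p)) ?_ ?_
  · rw [Submodule.dense_iff_topologicalClosure_eq_top]
    exact span_fourierLp_closure_eq_top hp
  · rintro _ ⟨n, rfl⟩
    exact h n

/-- `Φ P` is continuous on `L^p` and vanishes on all characters, the negative ones being killed by
`P`; trigonometric polynomials are dense. A general target `E` admits quotient maps, which turn this
into a density statement. -/
lemma clm_eq_zero_on_hardy {E : Type*} [NormedAddCommGroup E] [NormedSpace ℂ E]
    (hp : p ≠ ∞) (Φ : LpT p →L[ℂ] E) (h : ∀ n : ℤ, 0 ≤ n → Φ (fourierLp p n) = 0)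
    {f : LpT p} (hf : f ∈ hardy p) : Φ f = 0 := by
  have h1 : Φ ∘L (hardy p).subtypeL ∘L rieszProj p = 0 := by
    apply clm_eq_zero_of_fourierLp hp
    intro n
    change Φ (rieszProj p (fourierLp p n)) = 0
    rcases lt_or_ge n 0 with hn | hn
    · rw [(rieszProj_eq_zero_iff hP).mpr, Submodule.coe_zero, map_zero]
      intro k hk
      rw [fourierCoeff_fourierLp, if_neg (by omega)]
    · rw [rieszProj_of_mem hP (fourierLp_mem_hardy hn), h n hn]
  rw [← rieszProj_of_mem hP hf]
  exact DFunLike.congr_fun h1 f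

lemma clm_eq_zero_on_ker {E : Type*} [NormedAddCommGroup E] [NormedSpace ℂ E]
    (hp : p ≠ ∞) (Φ : LpT p →L[ℂ] E) (h : ∀ n : ℤ, n < 0 → Φ (fourierLp p n) = 0)
    {f : LpT p} (hf : rieszProj p f = 0) : Φ f = 0 := by
  have h1 : Φ ∘L (ContinuousLinearMap.id ℂ (LpT p) - (hardy p).subtypeL ∘L rieszProj p) = 0 := by
    apply clm_eq_zero_of_fourierLp hp
    intro n
    change Φ (fourierLp p n - (rieszProj p (fourierLp p n) : LpT p)) = 0
    rcases lt_or_ge n 0 with hn | hn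
    · rw [(rieszProj_eq_zero_iff hP).mpr, Submodule.coe_zero, sub_zero, h n hn]
      intro k hk
      rw [fourierCoeff_fourierLp, if_neg (by omega)]
    · rw [rieszProj_of_mem hP (fourierLp_mem_hardy hn), sub_self, map_zero]
  have h2 : Φ (f - (rieszProj p f : LpT p)) = 0 := DFunLike.congr_fun h1 f
  rwa [hf, Submodule.coe_zero, sub_zero] at h2

lemma exists_polynomial_approx (hp : p ≠ ∞) {f : LpT p} (hf : f ∈ hardy p) {η : ℝ} (hη : 0 < η) :
    ∃ q : Polynomial ℂ, ∫ θ, ‖f θ - q.eval (pt θ)‖ ∂mT ≤ η := by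
  let S : Submodule ℂ (LpT p) :=
    { carrier := {g | ∃ q : Polynomial ℂ, g =ᵐ[mT] fun θ => q.eval (pt θ)}
      zero_mem' := ⟨0, by
        filter_upwards [Lp.coeFn_zero ℂ p mT] with θ hθ
        rw [hθ]; simp⟩
      add_mem' := by
        rintro g g' ⟨q, hq⟩ ⟨q', hq'⟩
        refine ⟨q + q', ?_⟩
        filter_upwards [hq, hq', Lp.coeFn_add g g'] with θ h1 h2 h3
        rw [h3, Pi.add_apply, h1, h2, Polynomial.eval_add]
      smul_mem' := by
        rintro c g ⟨q, hq⟩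
        refine ⟨c • q, ?_⟩
        filter_upwards [hq, Lp.coeFn_smul c g] with θ h1 h3
        rw [h3, Pi.smul_apply, h1, Polynomial.eval_smul] }
  have hcl : f ∈ S.topologicalClosure := by
    have hS : IsClosed (S.topologicalClosure : Set (LpT p)) := S.isClosed_topologicalClosure
    -- The quotient map by the closure of the polynomials kills `t^n` for `n ≥ 0`, hence all of
    -- `H^p`.
    have h := clm_eq_zero_on_hardy hP hp S.topologicalClosure.mkQL (f := f) ?_ hf
    · exact (Submodule.Quotient.mk_eq_zero _).mp h
    · intro n hn
      refine (Submodule.Quotient.mk_eq_zero _).mpr (S.le_topologicalClosure ?_)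
      obtain ⟨k, rfl⟩ := Int.eq_ofNat_of_zero_le hn
      refine ⟨Polynomial.X ^ k, ?_⟩
      filter_upwards [coeFn_fourierLp' (p := p) (k : ℤ)] with θ hθ
      rw [hθ]; simp
  obtain ⟨g, ⟨q, hq⟩, hg⟩ := Metric.mem_closure_iff.mp hcl η hη
  refine ⟨q, ?_⟩
  have h1 : ∫ θ, ‖f θ - q.eval (pt θ)‖ ∂mT = (eLpNorm (fun θ => f θ - g θ) 1 mT).toReal := by
    have hi : Integrable (fun θ => f θ - g θ) mT :=
      (integrable_coeFn p f).sub (integrable_coeFn p g)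
    rw [eLpNorm_one_eq_lintegral_enorm, ← integral_norm_eq_lintegral_enorm hi.1]
    refine integral_congr_ae ?_
    filter_upwards [hq] with θ hθ
    rw [hθ]
  rw [h1]
  rw [dist_eq_norm, Lp.norm_def] at hg
  refine le_trans (ENNReal.toReal_mono (Lp.eLpNorm_ne_top _) ?_) hg.le
  refine (eLpNorm_le_eLpNorm_of_exponent_le (Fact.out : 1 ≤ p)
    ((Lp.memLp f).sub (Lp.memLp g)).1).trans_eq (eLpNorm_congr_ae ?_)
  exact (Lp.coeFn_sub f g).symm

omit hP in
lemma mulOp_zpow_coeff (f : LpT p) (m n : ℤ) :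
    fourierCoeff (mulOp p (fun θ => pt θ ^ m) f) n = fourierCoeff f (n - m) := by
  rw [fourierCoeff_congr_ae (coeFn_mulOp p (memLp_of_continuous (continuous_pt_zpow m) ∞) f),
    fourierCoeff_zpow_mul]

/-- A nonzero function from a Hardy space vanishes almost nowhere. -/
lemma ae_ne_zero_of_mem_hardy (hp : p ≠ ∞) {f : LpT p} (hf : f ∈ hardy p) (h0 : f ≠ 0) :
    ∀ᵐ θ ∂mT, f θ ≠ 0 := by
  classical
  have hex : ∃ n : ℕ, fourierCoeff f (n : ℤ) ≠ 0 := by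
    by_contra! h
    have h1 := (rieszProj_eq_zero_iff hP (f := f)).mpr fun n hn => by
      obtain ⟨k, rfl⟩ := Int.eq_ofNat_of_zero_le hn
      exact h k
    apply h0
    rw [← rieszProj_of_mem hP hf, h1, Submodule.coe_zero]
  -- Dividing by `t^N`, with `N` the index of the first nonzero coefficient, keeps `f` analytic and
  -- makes its mean nonzero.
  set N := Nat.find hex
  set g := mulOp p (fun θ => pt θ ^ (-(N : ℤ))) f
  have hgc : ∀ n, fourierCoeff g n = fourierCoeff f (n + N) := fun n => by
    rw [mulOp_zpow_coeff, sub_neg_eq_add]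
  have hgm : g ∈ hardy p := by
    intro n hn
    rw [hgc]
    rcases lt_or_ge (n + N) 0 with h | h
    · exact hf _ h
    · obtain ⟨k, hk⟩ := Int.eq_ofNat_of_zero_le h
      rw [hk]
      exact not_not.mp (Nat.find_min hex (m := k) (by omega))
  have hg0 : fourierCoeff g 0 ≠ 0 := by
    rw [hgc, zero_add]
    exact Nat.find_spec hex
  have hne := ae_ne_zero_of_polynomial_approx (integrable_coeFn p g)
    (fun η hη => exists_polynomial_approx hP hp hgm hη) hg0
  filter_upwards [hne, coeFn_mulOp p
    (memLp_of_continuous (continuous_pt_zpow (-(N : ℤ))) ∞) f] with θ h1 h2 h3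
  apply h1
  rw [h2, h3, mul_zero]

/-- The Coburn argument: an element of `H^p` which `d` multiplies out of the analytic functions
excludes functionals which annihilate the antianalytic functions and, after multiplication
by `d`, the analytic ones. -/
lemma coburn (hp : p ≠ ∞) {d : Torus → ℂ} (hd : MemLp d ∞ mT) (hd0 : ∀ᵐ θ ∂mT, d θ ≠ 0)
    {h : LpT p} (hh : h ∈ hardy p) (hh0 : h ≠ 0) (hdh : rieszProj p (mulOp p d h) = 0)
    (Φ : LpT p →L[ℂ] ℂ) (hΦ : ∀ f, rieszProj p f = 0 → Φ f = 0)
    (hΦd : ∀ f ∈ hardy p, Φ (mulOp p d f) = 0) : Φ = 0 := by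
  ext G
  refine eq_zero_of_continuousMul_fourier hp Φ (F := mulOp p d h) ?_ ?_
  -- Since `d h` vanishes almost nowhere, the support condition is vacuous and the multiples `t^n d
  -- h` span a dense subspace of `L^p`.
  · filter_upwards [coeFn_mulOp p hd h, hd0, ae_ne_zero_of_mem_hardy hP hp hh hh0]
      with θ h1 h2 h3 h4
    rw [h1] at h4
    exact absurd h4 (mul_ne_zero h2 h3)
  · intro n
    have hm := memLp_of_continuous (continuous_pt_zpow n) ∞
    have e : continuousMul (mulOp p d h) (fourier n) = mulOp p (fun θ => pt θ ^ n) (mulOp p d h) := by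
      apply Lp.ext
      filter_upwards [coeFn_continuousMul (mulOp p d h) (fourier n),
        coeFn_mulOp p hm (mulOp p d h)] with θ h1 h2
      rw [h1, h2, fourier_eq_pt_zpow]
    rw [e]
    -- For `n < 0` the product `t^n (d h)` stays antianalytic; for `n ≥ 0` it is `d (t^n h)` with
    -- `t^n h` in `H^p`.
    rcases lt_or_ge n 0 with hn | hn
    · apply hΦ
      rw [rieszProj_eq_zero_iff hP] at hdh ⊢
      intro k hk
      rw [mulOp_zpow_coeff]
      exact hdh _ (by omega)
    · have e2 : mulOp p (fun θ => pt θ ^ n) (mulOp p d h) =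
          mulOp p d (mulOp p (fun θ => pt θ ^ n) h) := by
        rw [mulOp_mulOp p hm hd, mulOp_mulOp p hd hm]
        simp only [mul_comm]
      rw [e2]
      apply hΦd
      intro k hk
      rw [mulOp_zpow_coeff]
      exact hh _ (by omega)

end Hardy

/-! ### The weighted shift exchanges analytic and antianalytic functions -/

section Shift

/-- The hypothesis reads `H_n = conj β * H_{n-1}` for `n > 0`. As `|β| > 1`, the coefficients would
grow geometrically, whereas those of an integrable function are bounded. The coefficient `H_0` is
covered as well. -/
lemma fourierCoeff_eq_zero_of_den_mul {β : ℂ} (hβ : 1 < ‖β‖) {H : Torus → ℂ}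
    (hH : Integrable H mT)
    (h : ∀ n : ℤ, 0 < n → fourierCoeff (fun θ => (conj β * pt θ - 1) * H θ) n = 0)
    (n : ℤ) (hn : 0 ≤ n) : fourierCoeff H n = 0 := by
  obtain ⟨k, rfl⟩ := Int.eq_ofNat_of_zero_le hn
  refine eq_zero_of_geometric_of_bounded (u := fun k : ℕ => fourierCoeff H (k : ℤ)) (z := conj β)
    (by rwa [RCLike.norm_conj]) (fun k => ?_) (fun k => norm_fourierCoeff_le H k) k
  have h1 := h (k + 1) (by positivity)
  rw [fourierCoeff_linear_mul hH, add_sub_cancel_right] at h1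
  push_cast
  linear_combination -h1

lemma fourierCoeff_eq_zero_of_num_mul {β : ℂ} (hβ : 1 < ‖β‖) {H : Torus → ℂ}
    (hH : Integrable H mT)
    (h : ∀ n : ℤ, n < 0 → fourierCoeff (fun θ => (1 * pt θ - β) * H θ) n = 0)
    (n : ℤ) (hn : n < 0) : fourierCoeff H n = 0 := by
  obtain ⟨k, rfl⟩ : ∃ k : ℕ, n = -1 - k := ⟨(-1 - n).toNat, by omega⟩
  refine eq_zero_of_geometric_of_bounded (u := fun k : ℕ => fourierCoeff H (-1 - k : ℤ)) (z := β)
    hβ (fun k => ?_) (fun k => norm_fourierCoeff_le H _) k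
  have h1 := h (-1 - k) (by omega)
  rw [fourierCoeff_linear_mul hH] at h1
  push_cast
  rw [show (-1 - (k + 1) : ℤ) = -1 - k - 1 by ring]
  linear_combination h1

variable {p : ℝ≥0∞} [Fact (1 ≤ p)] (β : ℂ) (hβ : 1 < ‖β‖)

lemma coeFn_weightedShift_fourierLp (n : ℤ) :
    weightedShift p β hβ (fourierLp p n) =ᵐ[mT]
      fun θ => lam β / (conj β * pt θ - 1) * moebius β (pt θ) ^ n := by
  filter_upwards [coeFn_weightedShift p β hβ (fourierLp p n),
    (quasi_shift β hβ).ae (coeFn_fourierLp' (p := p) n)] with θ h1 h2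
  rw [h1, h2, pt_shift]

lemma den_mul_weightedShift_zero :
    (fun θ => (conj β * pt θ - 1) * weightedShift p β hβ (fourierLp p 0) θ) =ᵐ[mT]
      fun _ => lam β * 1 := by
  filter_upwards [coeFn_weightedShift_fourierLp (p := p) β hβ 0] with θ h1
  rw [h1, zpow_zero, mul_one, mul_one, mul_div_cancel₀ _ (den_ne hβ (norm_pt θ))]

/-- Comes from `α(t) (conj β t - 1) = t - β`. It links the images of consecutive characters through
polynomial factors, so their spectra follow by induction without expanding powers of `α`. -/
lemma den_mul_weightedShift_succ (n : ℤ) :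
    (fun θ => (conj β * pt θ - 1) * weightedShift p β hβ (fourierLp p (n + 1)) θ) =ᵐ[mT]
      fun θ => (1 * pt θ - β) * weightedShift p β hβ (fourierLp p n) θ := by
  filter_upwards [coeFn_weightedShift_fourierLp (p := p) β hβ n,
    coeFn_weightedShift_fourierLp (p := p) β hβ (n + 1)] with θ h1 h2
  have hm : moebius β (pt θ) ≠ 0 := by
    rw [← norm_ne_zero_iff, norm_moebius hβ (norm_pt θ)]; exact one_ne_zero
  have h3 : moebius β (pt θ) * (conj β * pt θ - 1) = pt θ - β :=
    div_mul_cancel₀ _ (den_ne hβ (norm_pt θ))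
  rw [h1, h2, zpow_add_one₀ hm, one_mul, ← h3]
  ring

lemma num_mul_weightedShift_neg_one :
    (fun θ => (1 * pt θ - β) * weightedShift p β hβ (fourierLp p (-1)) θ) =ᵐ[mT]
      fun _ => lam β * 1 :=
  (den_mul_weightedShift_succ β hβ (-1)).symm.trans (den_mul_weightedShift_zero β hβ)

lemma fourierCoeff_weightedShift_nonneg (k : ℕ) (n : ℤ) (hn : 0 ≤ n) :
    fourierCoeff (weightedShift p β hβ (fourierLp p (k : ℤ))) n = 0 := by
  induction k generalizing n with
  | zero =>
    refine fourierCoeff_eq_zero_of_den_mul hβ (integrable_coeFn p _) (fun m hm => ?_) n hn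
    rw [Nat.cast_zero, fourierCoeff_congr_ae (den_mul_weightedShift_zero β hβ),
      fourierCoeff.const_mul, fourierCoeff_one, if_neg hm.ne', mul_zero]
  | succ k ih =>
    refine fourierCoeff_eq_zero_of_den_mul hβ (integrable_coeFn p _) (fun m hm => ?_) n hn
    rw [Nat.cast_succ, fourierCoeff_congr_ae (den_mul_weightedShift_succ β hβ k),
      fourierCoeff_linear_mul (integrable_coeFn p _), ih _ (by omega), ih _ hm.le]
    ring

lemma weightedShift_fourierLp_mem_hardy (n : ℤ) (hn : n < 0) :
    weightedShift p β hβ (fourierLp p n) ∈ hardy p := by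
  obtain ⟨k, rfl⟩ : ∃ k : ℕ, n = -1 - k := ⟨(-1 - n).toNat, by omega⟩
  clear hn
  induction k with
  | zero =>
    refine fourierCoeff_eq_zero_of_num_mul hβ (integrable_coeFn p _) (fun m hm => ?_)
    rw [Nat.cast_zero, sub_zero, fourierCoeff_congr_ae (num_mul_weightedShift_neg_one β hβ),
      fourierCoeff.const_mul, fourierCoeff_one, if_neg hm.ne, mul_zero]
  | succ k ih =>
    refine fourierCoeff_eq_zero_of_num_mul hβ (integrable_coeFn p _) (fun m hm => ?_)
    have h := den_mul_weightedShift_succ (p := p) β hβ (-1 - (k + 1 : ℕ))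
    rw [show (-1 - (k + 1 : ℕ) + 1 : ℤ) = -1 - k by push_cast; ring] at h
    rw [← fourierCoeff_congr_ae h, fourierCoeff_linear_mul (integrable_coeFn p _),
      ih _ (by omega), ih _ hm]
    ring

lemma rieszProj_weightedShift (hP : IsRieszProj p (rieszProj p)) (hp : p ≠ ∞) {f : LpT p}
    (hf : f ∈ hardy p) : rieszProj p (weightedShift p β hβ f) = 0 := by
  refine clm_eq_zero_on_hardy hP hp (rieszProj p ∘L weightedShift p β hβ) (fun n hn => ?_) hf
  obtain ⟨k, rfl⟩ := Int.eq_ofNat_of_zero_le hn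
  exact (rieszProj_eq_zero_iff hP).mpr (fourierCoeff_weightedShift_nonneg β hβ k)

lemma weightedShift_mem_hardy (hP : IsRieszProj p (rieszProj p)) (hp : p ≠ ∞) {f : LpT p}
    (hf : rieszProj p f = 0) : weightedShift p β hβ f ∈ hardy p := by
  have h := clm_eq_zero_on_ker hP hp
    (weightedShift p β hβ - (hardy p).subtypeL ∘L rieszProj p ∘L weightedShift p β hβ)
    (fun n hn => ?_) hf
  · have h' : weightedShift p β hβ f - (rieszProj p (weightedShift p β hβ f) : LpT p) = 0 := h
    rw [sub_eq_zero.mp h']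
    exact (rieszProj p _).2
  · change weightedShift p β hβ (fourierLp p n) -
      (rieszProj p (weightedShift p β hβ (fourierLp p n)) : LpT p) = 0
    rw [rieszProj_of_mem hP (weightedShift_fourierLp_mem_hardy β hβ n hn), sub_self]

end Shift

/-! ### Values in the disc -/

section DiskValue

variable {w : ℂ}

lemma pt_sub_ne_zero (hw : ‖w‖ < 1) (θ : Torus) : pt θ - w ≠ 0 := by
  intro h
  rw [sub_eq_zero] at h
  rw [← h, norm_pt] at hw
  exact lt_irrefl _ hw

/-- The Cauchy kernel of the point `w`. -/
def cauchyKernel (w : ℂ) (θ : Torus) : ℂ := pt θ / (pt θ - w)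

lemma continuous_cauchyKernel (hw : ‖w‖ < 1) : Continuous (cauchyKernel w) :=
  continuous_pt.div (continuous_pt.sub continuous_const) (pt_sub_ne_zero hw)

lemma memLp_cauchyKernel (hw : ‖w‖ < 1) (q : ℝ≥0∞) : MemLp (cauchyKernel w) q mT :=
  memLp_of_continuous (continuous_cauchyKernel hw) q

lemma summable_diskValue (hw : ‖w‖ < 1) (F : Torus → ℂ) :
    Summable fun k : ℕ => fourierCoeff F (k : ℤ) * w ^ k := by
  refine Summable.of_norm_bounded
    ((summable_geometric_of_lt_one (norm_nonneg w) hw).mul_left (∫ θ, ‖F θ‖ ∂mT)) fun k => ?_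
  rw [norm_mul, norm_pow]
  gcongr
  exact norm_fourierCoeff_le F k

/-- Cauchy's formula. -/
lemma diskValue_eq_integral (hw : ‖w‖ < 1) {F : Torus → ℂ} (hF : Integrable F mT) :
    diskValue F w = ∫ θ, cauchyKernel w θ * F θ ∂mT := by
  set G : Torus → ℂ := fun θ => cauchyKernel w θ * F θ
  obtain ⟨C, hC⟩ := (isCompact_range (continuous_cauchyKernel hw)).isBounded.exists_norm_le
  have hG : Integrable G mT :=
    hF.bdd_mul (continuous_cauchyKernel hw).aestronglyMeasurable
      (Filter.Eventually.of_forall fun θ => hC _ ⟨θ, rfl⟩)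
  -- From `(t - w) G = t F` the coefficients satisfy `F_k = G_k - w G_{k+1}`, so the partial sums of
  -- the series telescope to `G_0 - w^N G_N`.
  have hGF : (fun θ => (1 * pt θ - w) * G θ) = fun θ => pt θ * F θ := by
    ext θ
    have := pt_sub_ne_zero hw θ
    simp only [G, cauchyKernel, one_mul]
    field_simp
  have hrec : ∀ k : ℕ, fourierCoeff G (k : ℤ) =
      fourierCoeff F (k : ℤ) + w * fourierCoeff G ((k + 1 : ℕ) : ℤ) := by
    intro k
    have h := fourierCoeff_linear_mul hG 1 w (k + 1)
    rw [hGF, fourierCoeff_pt_mul, add_sub_cancel_right] at h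
    push_cast
    linear_combination -h
  have hsum : ∀ N : ℕ, ∑ k ∈ Finset.range N, fourierCoeff F (k : ℤ) * w ^ k =
      fourierCoeff G 0 - w ^ N * fourierCoeff G (N : ℤ) := by
    intro N
    induction N with
    | zero => simp
    | succ N ih =>
      rw [Finset.sum_range_succ, ih, hrec N]
      ring
  have hlim : Filter.Tendsto (fun N : ℕ => fourierCoeff G 0 - w ^ N * fourierCoeff G (N : ℤ))
      Filter.atTop (nhds (fourierCoeff G 0 - 0)) := by
    refine Filter.Tendsto.const_sub _ (squeeze_zero_norm
      (a := fun N => ‖w‖ ^ N * ∫ θ, ‖G θ‖ ∂mT) (fun N => ?_) ?_)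
    · rw [norm_mul, norm_pow]
      gcongr
      exact norm_fourierCoeff_le G N
    · simpa using (tendsto_pow_atTop_nhds_zero_of_lt_one (norm_nonneg w) hw).mul_const
        (∫ θ, ‖G θ‖ ∂mT)
  have h1 := (summable_diskValue hw F).hasSum.tendsto_sum_nat
  simp only [hsum] at h1
  rw [diskValue, tendsto_nhds_unique h1 hlim, sub_zero, fourierCoeff_eq]
  simp [G]

lemma diskValue_congr_ae {F G : Torus → ℂ} (h : F =ᵐ[mT] G) : diskValue F w = diskValue G w := by
  rw [diskValue, diskValue, fourierCoeff_congr_ae h]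

lemma diskValue_const_mul (c : ℂ) (F : Torus → ℂ) :
    diskValue (fun θ => c * F θ) w = c * diskValue F w := by
  simp only [diskValue, fourierCoeff.const_mul, mul_assoc, tsum_mul_left]

lemma diskValue_one : diskValue (fun _ => 1) w = 1 := by
  rw [diskValue, tsum_eq_single 0]
  · simp [fourierCoeff_one]
  · intro k hk
    rw [fourierCoeff_one, if_neg (by simpa using hk), zero_mul]

lemma diskValue_pt_mul (hw : ‖w‖ < 1) {F : Torus → ℂ} (h : fourierCoeff F (-1) = 0) :
    diskValue (fun θ => pt θ * F θ) w = w * diskValue F w := by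
  rw [diskValue, (summable_diskValue hw _).tsum_eq_zero_add, diskValue, ← tsum_mul_left]
  simp only [fourierCoeff_pt_mul]
  rw [Nat.cast_zero, zero_sub, h, zero_mul, zero_add]
  refine tsum_congr fun k => ?_
  push_cast
  rw [add_sub_cancel_right]
  ring

lemma diskValue_pow_mul (hw : ‖w‖ < 1) {F : Torus → ℂ} (h : ∀ n : ℤ, n < 0 → fourierCoeff F n = 0)
    (k : ℕ) : diskValue (fun θ => pt θ ^ (k : ℤ) * F θ) w = w ^ k * diskValue F w := by
  induction k with
  | zero => simp
  | succ k ih =>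
    have e : (fun θ => pt θ ^ ((k + 1 : ℕ) : ℤ) * F θ) =
        fun θ => pt θ * (pt θ ^ (k : ℤ) * F θ) := by
      ext θ
      rw [Nat.cast_succ, zpow_add_one₀ (pt_ne_zero θ)]
      ring
    rw [e, diskValue_pt_mul hw, ih]
    · ring
    · rw [fourierCoeff_zpow_mul]
      exact h _ (by omega)

lemma diskValue_linear_mul (hw : ‖w‖ < 1) {F : Torus → ℂ} (hF : Integrable F mT)
    (h : fourierCoeff F (-1) = 0) (x y : ℂ) :
    diskValue (fun θ => (x * pt θ - y) * F θ) w = (x * w - y) * diskValue F w := by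
  have h1 := diskValue_pt_mul hw h
  simp only [diskValue] at h1 ⊢
  have e : ∀ k : ℕ, fourierCoeff (fun θ => (x * pt θ - y) * F θ) (k : ℤ) * w ^ k =
      x * (fourierCoeff (fun θ => pt θ * F θ) (k : ℤ) * w ^ k) -
        y * (fourierCoeff F (k : ℤ) * w ^ k) := by
    intro k
    rw [fourierCoeff_linear_mul hF, fourierCoeff_pt_mul]
    ring
  simp only [e]
  rw [((summable_diskValue hw _).mul_left x).tsum_sub ((summable_diskValue hw _).mul_left y),
    tsum_mul_left, tsum_mul_left, h1]
  ring

variable {p : ℝ≥0∞} [Fact (1 ≤ p)]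

/-- Evaluation at a point of the disc is multiplicative. -/
lemma diskValue_mul (hP : IsRieszProj p (rieszProj p)) (hp : p ≠ ∞) (hw : ‖w‖ < 1)
    {f : LpT p} (hf : f ∈ hardy p) {G : Torus → ℂ} (hG : MemHardy G p.conjExponent) :
    diskValue (fun θ => G θ * f θ) w = diskValue G w * diskValue f w := by
  have hκ := memLp_cauchyKernel hw p.conjExponent
  have hκG : MemLp (fun θ => cauchyKernel w θ * G θ) p.conjExponent mT :=
    hG.1.mul (memLp_cauchyKernel hw ∞)
  have hGf : ∀ f : LpT p, Integrable (fun θ => G θ * f θ) mT := fun f =>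
    memLp_one_iff_integrable.mp ((Lp.memLp f).mul hG.1)
  have e1 : ∀ f : LpT p, pairing hκG f = diskValue (fun θ => G θ * f θ) w := fun f => by
    rw [pairing_apply, diskValue_eq_integral hw (hGf f)]
    simp only [mul_assoc]
  have e2 : ∀ f : LpT p, pairing hκ f = diskValue f w := fun f => by
    rw [pairing_apply, diskValue_eq_integral hw (integrable_coeFn p f)]
  -- By Cauchy's formula both sides are bounded functionals of `f`, so only `f = t^k` has to be
  -- tested.
  have h := clm_eq_zero_on_hardy hP hp (pairing hκG - diskValue G w • pairing hκ)
    (fun n hn => ?_) hf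
  · have h' : pairing hκG f - diskValue G w * pairing hκ f = 0 := h
    rw [e1, e2] at h'
    exact sub_eq_zero.mp h'
  · change pairing hκG (fourierLp p n) - diskValue G w * pairing hκ (fourierLp p n) = 0
    obtain ⟨k, rfl⟩ := Int.eq_ofNat_of_zero_le hn
    have a1 : (fun θ => G θ * (fourierLp p (k : ℤ) : LpT p) θ) =ᵐ[mT]
        fun θ => pt θ ^ (k : ℤ) * G θ := by
      filter_upwards [coeFn_fourierLp' (p := p) (k : ℤ)] with θ hθ
      rw [hθ, mul_comm]
    have a2 : (fourierLp p (k : ℤ) : LpT p) =ᵐ[mT] fun θ => pt θ ^ (k : ℤ) * 1 := by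
      filter_upwards [coeFn_fourierLp' (p := p) (k : ℤ)] with θ hθ
      rw [hθ, mul_one]
    rw [e1, e2, diskValue_congr_ae a1, diskValue_congr_ae a2, diskValue_pow_mul hw hG.2,
      diskValue_pow_mul hw (fun n hn => by rw [fourierCoeff_one, if_neg hn.ne]), diskValue_one]
    ring

lemma norm_one_div_conj_lt {β : ℂ} (hβ : 1 < ‖β‖) : ‖1 / conj β‖ < 1 := by
  rw [norm_div, norm_one, RCLike.norm_conj]
  exact (div_lt_one (by linarith)).mpr hβ

lemma conj_ne_zero {β : ℂ} (hβ : 1 < ‖β‖) : conj β ≠ 0 := by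
  rw [← norm_ne_zero_iff, RCLike.norm_conj]
  linarith

/-- `α` sends `1 / conj β` to infinity, so the value of `J_α u` there sees only the leading term of
`u` at infinity, its coefficient at `t⁻¹`. The factor is the value of `J_α t⁻¹ = λ / (t - β)`,
simplified by `λ² = 1 - |β|²`. -/
lemma diskValue_weightedShift (β : ℂ) (hβ : 1 < ‖β‖) (hP : IsRieszProj p (rieszProj p))
    (hp : p ≠ ∞) {u : LpT p} (hu : rieszProj p u = 0) :
    diskValue (weightedShift p β hβ u) (1 / conj β) =
      conj β / lam β * fourierCoeff u (-1) := by
  have hw := norm_one_div_conj_lt hβ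
  have hb := conj_ne_zero hβ
  have hl := lam_ne_zero β hβ
  have hκ := memLp_cauchyKernel hw p.conjExponent
  have hpt : MemLp pt p.conjExponent mT := memLp_of_continuous continuous_pt _
  have e1 : ∀ f : LpT p, pairing hκ f = diskValue f (1 / conj β) := fun f => by
    rw [pairing_apply, diskValue_eq_integral hw (integrable_coeFn p f)]
  have e2 : ∀ f : LpT p, pairing hpt f = fourierCoeff f (-1) := fun f => by
    rw [pairing_apply, fourierCoeff_eq, neg_neg]
    simp only [zpow_one]
  have h := clm_eq_zero_on_ker hP hp
    (pairing hκ ∘L weightedShift p β hβ - (conj β / lam β) • pairing hpt) (fun n hn => ?_) hu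
  · have h' : pairing hκ (weightedShift p β hβ u) - conj β / lam β * pairing hpt u = 0 := h
    rw [e1, e2] at h'
    exact sub_eq_zero.mp h'
  · change pairing hκ (weightedShift p β hβ (fourierLp p n)) -
      conj β / lam β * pairing hpt (fourierLp p n) = 0
    rw [e1, e2, fourierCoeff_fourierLp]
    have hmem := weightedShift_fourierLp_mem_hardy (p := p) β hβ n hn
    have hnum := diskValue_linear_mul hw (integrable_coeFn p _) (hmem (-1) (by norm_num)) 1 β
    have hden : 1 - conj β * β ≠ 0 := by
      rw [← lam_sq β hβ]; exact mul_self_ne_zero.mpr hl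
    have hwβ : 1 * (1 / conj β) - β ≠ 0 := by
      intro h0
      apply hden
      field_simp at h0
      linear_combination h0
    rcases eq_or_ne n (-1) with rfl | hne
    · rw [diskValue_congr_ae (num_mul_weightedShift_neg_one β hβ), diskValue_const_mul,
        diskValue_one, mul_one] at hnum
      rw [if_pos rfl, mul_one, sub_eq_zero, eq_div_iff hl]
      apply mul_left_cancel₀ hwβ
      have hsq := lam_sq β hβ
      rw [← mul_assoc, ← hnum, hsq]
      field_simp
    · rw [if_neg (Ne.symm hne), mul_zero, sub_zero]
      -- Here `n + 1` is still negative, so `J_α t^{n+1}` has a value at `1 / conj β`; the factor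
      -- `conj β t - 1` vanishes at that point while `t - β` does not.
      have hmem' := weightedShift_fourierLp_mem_hardy (p := p) β hβ (n + 1) (by omega)
      have hd := diskValue_linear_mul hw (integrable_coeFn p _) (hmem' (-1) (by norm_num))
        (conj β) 1
      rw [diskValue_congr_ae (den_mul_weightedShift_succ β hβ n), hnum,
        mul_one_div_cancel hb, sub_self, zero_mul] at hd
      exact (mul_eq_zero.mp hd).resolve_left hwβ

end DiskValue

/-! ### Kernels and cokernels of Toeplitz plus Hankel operators -/

section Functionals

variable {p : ℝ≥0∞} [Fact (1 ≤ p)] {c : Torus → ℂ}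

/-- A functional on `L^p` that annihilates the antianalytic functions is determined by its
restriction to `H^p`. -/
lemma apply_rieszProj (hP : IsRieszProj p (rieszProj p)) {Θ : LpT p →L[ℂ] ℂ}
    (hΘ : ∀ f, rieszProj p f = 0 → Θ f = 0) (f : LpT p) : Θ (rieszProj p f : LpT p) = Θ f := by
  have h : rieszProj p (f - (rieszProj p f : LpT p)) = 0 := by
    rw [map_sub, sub_eq_zero]
    exact Subtype.ext (rieszProj_of_mem hP (rieszProj p f).2).symm
  have h2 := hΘ _ h
  rw [map_sub, sub_eq_zero] at h2
  exact h2.symm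

lemma comp_subtypeL_mem_coker (hP : IsRieszProj p (rieszProj p)) {Θ : LpT p →L[ℂ] ℂ}
    (hΘ : ∀ f, rieszProj p f = 0 → Θ f = 0) (hΘc : ∀ f ∈ hardy p, Θ (mulOp p c f) = 0) :
    Θ ∘L (hardy p).subtypeL ∈ coker (toeplitz p c) := by
  rw [mem_coker]
  ext f
  change Θ (rieszProj p (mulOp p c f) : LpT p) = 0
  rw [apply_rieszProj hP hΘ]
  exact hΘc f f.2

lemma eq_zero_of_coker_eq_bot (hP : IsRieszProj p (rieszProj p))
    (hcok : coker (toeplitz p c) = ⊥) {Θ : LpT p →L[ℂ] ℂ}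
    (hΘ : ∀ f, rieszProj p f = 0 → Θ f = 0) (hΘc : ∀ f ∈ hardy p, Θ (mulOp p c f) = 0) :
    Θ = 0 := by
  have h := comp_subtypeL_mem_coker hP hΘ hΘc
  rw [hcok, Submodule.mem_bot] at h
  ext f
  rw [← apply_rieszProj hP hΘ f]
  exact DFunLike.congr_fun h (rieszProj p f)

/-- Coburn's theorem for Toeplitz operators. -/
lemma coker_toeplitz_eq_bot (hP : IsRieszProj p (rieszProj p)) (hp : p ≠ ∞) (hc : MemLp c ∞ mT)
    (hc0 : ∀ᵐ θ ∂mT, c θ ≠ 0) {f : hardy p} (hf : f ∈ (toeplitz p c).ker) (hf0 : f ≠ 0) :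
    coker (toeplitz p c) = ⊥ := by
  rw [Submodule.eq_bot_iff]
  intro φ hφ
  have h : φ ∘L rieszProj p = 0 := by
    refine coburn hP hp hc hc0 f.2 (fun h => hf0 (Subtype.ext h)) hf _ (fun g hg => ?_)
      (fun g hg => ?_)
    · rw [ContinuousLinearMap.comp_apply, hg, map_zero]
    · exact DFunLike.congr_fun ((mem_coker _ φ).mp hφ) ⟨g, hg⟩
  ext g
  have h1 := DFunLike.congr_fun h (g : LpT p)
  have h2 : rieszProj p (g : LpT p) = g := Subtype.ext (rieszProj_of_mem hP g.2)
  rwa [ContinuousLinearMap.comp_apply, h2] at h1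

lemma ker_toeplitz_eq_bot (hP : IsRieszProj p (rieszProj p)) (hp : p ≠ ∞) (hc : MemLp c ∞ mT)
    (hc0 : ∀ᵐ θ ∂mT, c θ ≠ 0) (h : coker (toeplitz p c) ≠ ⊥) : (toeplitz p c).ker = ⊥ := by
  rw [Submodule.eq_bot_iff]
  intro f hf
  by_contra hf0
  exact h (coker_toeplitz_eq_bot hP hp hc hc0 hf hf0)

/-- The continuous functionals killing the range embed in its algebraic annihilator, the dual of the
finite-dimensional quotient by the range. This is needed because `finrank` is `0` on
infinite-dimensional spaces. -/
lemma finiteDimensional_coker {X : Type*} [NormedAddCommGroup X] [NormedSpace ℂ X] {A : X →L[ℂ] X}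
    (hA : A.IsFredholm) : FiniteDimensional ℂ (coker A) := by
  have h1 : Module.Finite ℂ (X ⧸ A.range) := hA.finite_coker
  have h2 : Module.Finite ℂ A.range.dualAnnihilator :=
    Module.Finite.equiv A.range.dualQuotEquivDualAnnihilator
  let L : coker A →ₗ[ℂ] A.range.dualAnnihilator :=
    { toFun := fun φ => ⟨φ.1.toLinearMap, by
        rw [Submodule.mem_dualAnnihilator]
        rintro _ ⟨x, rfl⟩
        exact DFunLike.congr_fun ((mem_coker A φ.1).mp φ.2) x⟩
      map_add' := fun _ _ => rfl
      map_smul' := fun _ _ => rfl }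
  refine Module.Finite.of_injective L fun φ ψ h => ?_
  apply Subtype.ext
  ext x
  exact DFunLike.congr_fun (congrArg Subtype.val h) x

/-- By Coburn's theorem one of the two spaces is trivial, and equal dimensions make the other
trivial too. -/
lemma ker_coker_eq_bot_of_ind_eq_zero (hP : IsRieszProj p (rieszProj p)) (hp : p ≠ ∞)
    (hc : MemLp c ∞ mT) (hc0 : ∀ᵐ θ ∂mT, c θ ≠ 0) (hF : (toeplitz p c).IsFredholm)
    (hi : ind (toeplitz p c) = 0) :
    (toeplitz p c).ker = ⊥ ∧ coker (toeplitz p c) = ⊥ := by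
  have := hF.finite_ker
  have := finiteDimensional_coker hF
  rw [ind] at hi
  by_cases h : coker (toeplitz p c) = ⊥
  · refine ⟨?_, h⟩
    rw [h, finrank_bot] at hi
    exact Submodule.finrank_eq_zero.mp (by simpa using hi)
  · have hk := ker_toeplitz_eq_bot hP hp hc hc0 h
    refine ⟨hk, ?_⟩
    rw [hk, finrank_bot] at hi
    exact Submodule.finrank_eq_zero.mp (by simpa using hi)

end Functionals

/-! ### The operator `a + s b J_α` and the reduction to `T(c)` -/

section Pair

variable {p : ℝ≥0∞} [Fact (1 ≤ p)] {β : ℂ} {hβ : 1 < ‖β‖} {a b : Torus → ℂ}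

/-- The operator `a I + s b J_α` on `L^p`. -/
def shiftOp (p : ℝ≥0∞) [Fact (1 ≤ p)] (β : ℂ) (hβ : 1 < ‖β‖) (a b : Torus → ℂ) (s : ℂ) :
    LpT p →L[ℂ] LpT p :=
  mulOp p a + s • (mulOp p b ∘L weightedShift p β hβ)

lemma coeFn_shiftOp (ha : MemLp a ∞ mT) (hb : MemLp b ∞ mT) (s : ℂ) (f : LpT p) :
    shiftOp p β hβ a b s f =ᵐ[mT]
      fun θ => a θ * f θ + s * (b θ * weightedShift p β hβ f θ) := by
  filter_upwards [coeFn_mulOp p ha f, coeFn_mulOp p hb (weightedShift p β hβ f),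
    Lp.coeFn_add (mulOp p a f) (s • mulOp p b (weightedShift p β hβ f)),
    Lp.coeFn_smul s (mulOp p b (weightedShift p β hβ f))] with θ h1 h2 h3 h4
  change (mulOp p a f + s • mulOp p b (weightedShift p β hβ f) : LpT p) θ = _
  rw [h3, Pi.add_apply, h4, Pi.smul_apply, h1, h2, smul_eq_mul]

/-- `J_α` maps `H^p` into `ker P`, so `Q` acts as the identity in the Hankel operator. -/
lemma toeplitz_add_hankel_apply (hP : IsRieszProj p (rieszProj p)) (hp : p ≠ ∞) (s : ℂ)
    (f : hardy p) : (toeplitz p a + s • hankel p β hβ b) f =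
      rieszProj p (shiftOp p β hβ a b s f) := by
  have h : compProj p (weightedShift p β hβ f) = weightedShift p β hβ f := by
    change weightedShift p β hβ (f : LpT p) -
      (rieszProj p (weightedShift p β hβ (f : LpT p)) : LpT p) = _
    rw [rieszProj_weightedShift β hβ hP hp f.2, Submodule.coe_zero, sub_zero]
  change rieszProj p (mulOp p a f) + s • rieszProj p (mulOp p b (compProj p
    (weightedShift p β hβ f))) = rieszProj p (mulOp p a f + s • mulOp p b (weightedShift p β hβ f))
  rw [h, map_add, map_smul]

lemma eq_zero_of_ker_toeplitz_eq_bot {c : Torus → ℂ} (hβ : 1 < ‖β‖)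
    (hP : IsRieszProj p (rieszProj p)) (hp : p ≠ ∞) (hker : (toeplitz p c).ker = ⊥) {s : ℂ}
    {f : LpT p} (hf : f ∈ hardy p) (h : mulOp p c f = -(s • weightedShift p β hβ f)) : f = 0 := by
  have h1 : (⟨f, hf⟩ : hardy p) ∈ (toeplitz p c).ker := by
    change rieszProj p (mulOp p c f) = 0
    rw [h, map_neg, map_smul, rieszProj_weightedShift β hβ hP hp hf, smul_zero, neg_zero]
  rw [hker, Submodule.mem_bot] at h1
  exact congrArg Subtype.val h1

lemma IsMatchingPair.exists_inverse (h : IsMatchingPair β hβ a b) :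
    ∃ a' b' : Torus → ℂ, MemLp a' ∞ mT ∧ MemLp b' ∞ mT ∧ (∀ᵐ θ ∂mT, a θ * a' θ = 1) ∧
      ∀ᵐ θ ∂mT, b θ * b' θ = 1 := by
  obtain ⟨ha, a', ha', haa'⟩ := h.unit_left
  -- By the matching condition `b b_α = a a_α`, so `b_α / (a a_α)` inverts `b`.
  refine ⟨a', fun θ => b (shift β hβ θ) * (a' θ * a' (shift β hβ θ)), ha',
    memLp_top_mul (memLp_top_shift β hβ h.mem_right)
      (memLp_top_mul ha' (memLp_top_shift β hβ ha')), haa', ?_⟩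
  filter_upwards [h.matching, haa', (quasi_shift β hβ).ae haa'] with θ h1 h2 h3
  rw [← mul_assoc, ← h1]
  linear_combination (a (shift β hβ θ) * a' (shift β hβ θ)) * h2 + h3

lemma IsMatchingPair.subordinated_mem (h : IsMatchingPair β hβ a b) :
    MemLp (subordinated a b) ∞ mT := by
  obtain ⟨a', b', -, hb', -, hbb'⟩ := h.exists_inverse
  refine (memLp_congr_ae ?_).mp (memLp_top_mul h.unit_left.1 hb')
  filter_upwards [hbb'] with θ h1
  rw [subordinated, eq_inv_of_mul_eq_one_right h1]

lemma IsMatchingPair.subordinated_ne_zero (h : IsMatchingPair β hβ a b) :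
    ∀ᵐ θ ∂mT, subordinated a b θ ≠ 0 := by
  obtain ⟨a', b', -, -, haa', hbb'⟩ := h.exists_inverse
  filter_upwards [haa', hbb'] with θ h1 h2
  exact mul_ne_zero (left_ne_zero_of_mul_eq_one h1)
    (inv_ne_zero (left_ne_zero_of_mul_eq_one h2))

/-- The dichotomy for `T(a) + s H_α(b)`, reduced to the Toeplitz operator `T(c)`. -/
theorem ker_eq_bot_or_coker_eq_bot (hP : IsRieszProj p (rieszProj p)) (hp : p ≠ ∞)
    (hab : IsMatchingPair β hβ a b) {s : ℂ} (hs : s * s = 1)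
    (hK : ∀ f ∈ hardy p, mulOp p (subordinated a b) f = -(s • weightedShift p β hβ f) → f = 0)
    (hC : ∀ Θ : LpT p →L[ℂ] ℂ, (∀ f, rieszProj p f = 0 → Θ f = 0) →
      (∀ f ∈ hardy p, Θ (mulOp p (subordinated a b) f) = 0) →
      (∀ f, Θ (mulOp p (subordinated a b) (weightedShift p β hβ f)) = s * Θ f) → Θ = 0) :
    (toeplitz p a + s • hankel p β hβ b).ker = ⊥ ∨
      coker (toeplitz p a + s • hankel p β hβ b) = ⊥ := by
  obtain ⟨a', b', ha', hb', haa', hbb'⟩ := hab.exists_inverse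
  have ha := hab.unit_left.1
  have hb := hab.mem_right
  have hc := hab.subordinated_mem
  have hmat := hab.matching
  have hs0 : s ≠ 0 := left_ne_zero_of_mul_eq_one hs
  have hbs := (quasi_shift β hβ).ae hbb'
  have has := (quasi_shift β hβ).ae haa'
  set J := weightedShift p β hβ
  set T := shiftOp p β hβ a b s
  set c := subordinated a b
  set d : Torus → ℂ := fun θ => a θ * b' (shift β hβ θ) with hd
  set c' : Torus → ℂ := fun θ => b θ * a' θ with hc'
  have hdm : MemLp d ∞ mT := memLp_top_mul ha (memLp_top_shift β hβ hb')
  have hcm : MemLp c' ∞ mT := memLp_top_mul hb ha'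
  have hJJ : ∀ f, J (J f) = f := weightedShift_weightedShift p β hβ
  have hT : ∀ f, T f =ᵐ[mT] fun θ => a θ * f θ + s * (b θ * J f θ) := coeFn_shiftOp ha hb s
  -- `J` swaps the two terms of `T` and shifts their coefficients; multiplying by `d = a / b_α`
  -- restores `a`, and restores `b` because `a a_α / b_α = b`.
  have hdJT : ∀ f, mulOp p d (J (T f)) = s • T f := by
    intro f
    have e : J (T f) = shiftOp p β hβ (fun θ => s * b (shift β hβ θ))
        (fun θ => s * a (shift β hβ θ)) s f := by
      change J (mulOp p a f + s • mulOp p b (J f)) = _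
      rw [map_add, map_smul, weightedShift_mulOp p β hβ ha, weightedShift_mulOp p β hβ hb, hJJ]
      apply Lp.ext
      filter_upwards [coeFn_mulOp p (memLp_top_shift β hβ ha) (J f),
        coeFn_mulOp p (memLp_top_shift β hβ hb) f,
        coeFn_shiftOp (p := p) (β := β) (hβ := hβ) ((memLp_top_shift β hβ hb).const_mul s)
          ((memLp_top_shift β hβ ha).const_mul s) s f,
        Lp.coeFn_add (mulOp p (fun θ => a (shift β hβ θ)) (J f))
          (s • mulOp p (fun θ => b (shift β hβ θ)) f),
        Lp.coeFn_smul s (mulOp p (fun θ => b (shift β hβ θ)) f)] with θ h1 h2 h3 h4 h5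
      rw [h3, h4, Pi.add_apply, h5, Pi.smul_apply, h1, h2, smul_eq_mul]
      linear_combination -(a (shift β hβ θ) * J f θ) * hs
    apply Lp.ext
    filter_upwards [coeFn_mulOp p hdm (J (T f)), Lp.coeFn_smul s (T f), hT f, hmat, hbs,
      coeFn_shiftOp (p := p) (β := β) (hβ := hβ) ((memLp_top_shift β hβ hb).const_mul s)
          ((memLp_top_shift β hβ ha).const_mul s) s f] with θ h1 h2 h3 h4 h5 h6
    rw [h1, h2, Pi.smul_apply, h3, e, h6, smul_eq_mul, hd]
    change a θ * b' (shift β hβ θ) * (s * b (shift β hβ θ) * f θ +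
      s * (s * a (shift β hβ θ) * J f θ)) = s * (a θ * f θ + s * (b θ * J f θ))
    linear_combination (s * a θ * f θ + s * s * b θ * J f θ) * h5 +
      (s * s * b' (shift β hβ θ) * J f θ) * h4
  have hTJ : ∀ f, T (J f) = s • T (mulOp p c' f) := by
    intro f
    have e := weightedShift_mulOp p β hβ hcm f
    apply Lp.ext
    filter_upwards [hT (J f), Lp.coeFn_smul s (T (mulOp p c' f)), hT (mulOp p c' f),
      coeFn_mulOp p hcm f, coeFn_mulOp p (memLp_top_shift β hβ hcm) (J f), hmat, haa', has]
      with θ h1 h2 h3 h4 h5 h6 h7 h8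
    rw [h1, h2, Pi.smul_apply, h3, h4, e, h5, hJJ, smul_eq_mul]
    change a θ * J f θ + s * (b θ * f θ) = s * (a θ * (b θ * a' θ * f θ) +
      s * (b θ * (b (shift β hβ θ) * a' (shift β hβ θ) * J f θ)))
    linear_combination -(s * b θ * f θ) * h7 - (a θ * J f θ) * h8 +
      (a' (shift β hβ θ) * J f θ) * h6 - (b θ * b (shift β hβ θ) * a' (shift β hβ θ) * J f θ) * hs
  have hTd : ∀ f, T (mulOp p (fun θ => b' (shift β hβ θ)) f) = mulOp p d f + s • J f := by
    intro f
    have e := weightedShift_mulOp p β hβ (memLp_top_shift β hβ hb') f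
    simp only [shift_shift] at e
    apply Lp.ext
    filter_upwards [hT (mulOp p (fun θ => b' (shift β hβ θ)) f),
      coeFn_mulOp p (memLp_top_shift β hβ hb') f, coeFn_mulOp p hb' (J f), coeFn_mulOp p hdm f,
      Lp.coeFn_add (mulOp p d f) (s • J f), Lp.coeFn_smul s (J f), hbb'] with θ h1 h2 h3 h4 h5 h6 h7
    rw [h1, h2, e, h3, h5, Pi.add_apply, h6, Pi.smul_apply, h4, smul_eq_mul, hd]
    linear_combination (s * J f θ) * h7
  have hcc' : ∀ f, mulOp p c' (mulOp p c f) = f := by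
    intro f
    apply Lp.ext
    filter_upwards [coeFn_mulOp p hcm (mulOp p c f), coeFn_mulOp p hc f, haa', hbb']
      with θ h1 h2 h3 h4
    rw [h1, h2]
    have hb0 : b θ ≠ 0 := left_ne_zero_of_mul_eq_one h4
    change b θ * a' θ * (a θ * (b θ)⁻¹ * f θ) = f θ
    field_simp
    linear_combination f θ * h3
  rw [or_iff_not_imp_left]
  intro hker
  obtain ⟨f, hf, hf0⟩ := Submodule.exists_mem_ne_zero_of_ne_bot hker
  have hPT : rieszProj p (T f) = 0 := by
    rw [← toeplitz_add_hankel_apply hP hp]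
    exact hf
  have hh : J (T f) ∈ hardy p := weightedShift_mem_hardy β hβ hP hp hPT
  -- If `J T f = 0`, then `T f = 0`, that is `c f = -s J f`, the exceptional case excluded by `hK`.
  have hh0 : J (T f) ≠ 0 := by
    intro h0
    have hTf : T f = 0 := by rw [← hJJ (T f), h0, map_zero]
    apply hf0
    apply Subtype.ext
    refine hK f f.2 ?_
    apply Lp.ext
    have hz : (T f : Torus → ℂ) =ᵐ[mT] 0 := by rw [hTf]; exact Lp.coeFn_zero ℂ p mT
    filter_upwards [hT f, hz, coeFn_mulOp p hc (f : LpT p), Lp.coeFn_neg (s • J f),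
      Lp.coeFn_smul s (J f), hbb'] with θ h1 h2 h3 h4 h5 h6
    rw [h3, h4, Pi.neg_apply, h5, Pi.smul_apply, smul_eq_mul]
    rw [h2, Pi.zero_apply] at h1
    have hb0 : b θ ≠ 0 := left_ne_zero_of_mul_eq_one h6
    change a θ * (b θ)⁻¹ * (f : LpT p) θ = _
    field_simp
    linear_combination -h1
  have hd0 : ∀ᵐ θ ∂mT, d θ ≠ 0 := by
    filter_upwards [haa', hbs] with θ h1 h2
    exact mul_ne_zero (left_ne_zero_of_mul_eq_one h1) (right_ne_zero_of_mul_eq_one h2)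
  have hdh : rieszProj p (mulOp p d (J (T f))) = 0 := by rw [hdJT, map_smul, hPT, smul_zero]
  rw [Submodule.eq_bot_iff]
  intro φ hφ
  have hφA : ∀ g ∈ hardy p, φ (rieszProj p (T g)) = 0 := by
    intro g hg
    have h1 := DFunLike.congr_fun ((mem_coker _ φ).mp hφ) ⟨g, hg⟩
    rwa [ContinuousLinearMap.comp_apply, toeplitz_add_hankel_apply hP hp] at h1
  have hΘJ : ∀ g, φ (rieszProj p (T (J g))) = s * φ (rieszProj p (T (mulOp p c' g))) := by
    intro g
    rw [hTJ, map_smul, map_smul, smul_eq_mul]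
  -- For `g ∈ ker P` the function `J g` is in `H^p`, where `φ P T` vanishes; `T J = s T c'` turns
  -- this into the vanishing of `φ P T c'` at `g`.
  have hΘ : φ ∘L rieszProj p ∘L T ∘L mulOp p c' = 0 := by
    refine hC _ (fun g hg => ?_) (fun g hg => ?_) (fun g => ?_)
    · have h1 := hφA _ (weightedShift_mem_hardy β hβ hP hp hg)
      exact (mul_eq_zero.mp ((hΘJ g).symm.trans h1)).resolve_left hs0
    · change φ (rieszProj p (T (mulOp p c' (mulOp p c g)))) = 0
      rw [hcc']
      exact hφA g hg
    · change φ (rieszProj p (T (mulOp p c' (mulOp p c (J g))))) = _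
      rw [hcc']
      exact hΘJ g
  have hΨ : ∀ g, φ (rieszProj p (T g)) = 0 := by
    intro g
    rw [← hJJ g, hΘJ]
    exact mul_eq_zero_of_right _ (DFunLike.congr_fun hΘ (J g))
  -- `φ P T` now vanishes on all of `L^p`. At `g / b_α` with `g ∈ H^p` one has `T (g / b_α) = d g +
  -- s J g`, and `P` kills `J g`, so `φ P` annihilates `d H^p`.
  have hΦ : φ ∘L rieszProj p = 0 := by
    refine coburn hP hp hdm hd0 hh hh0 hdh _ (fun g hg => ?_) (fun g hg => ?_)
    · rw [ContinuousLinearMap.comp_apply, hg, map_zero]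
    · have h1 := hΨ (mulOp p (fun θ => b' (shift β hβ θ)) g)
      rw [hTd, map_add, map_smul, rieszProj_weightedShift β hβ hP hp hg, smul_zero, add_zero] at h1
      exact h1
  ext g
  have h1 := DFunLike.congr_fun hΦ (g : LpT p)
  have h2 : rieszProj p (g : LpT p) = g := Subtype.ext (rieszProj_of_mem hP g.2)
  rwa [ContinuousLinearMap.comp_apply, h2] at h1

end Pair

/-! ### Signature -/

section Signature

variable {p : ℝ≥0∞} [Fact (1 ≤ p)] {β : ℂ} {c : Torus → ℂ}

lemma isSignature_of_signature_eq_one (h : signature p β c = 1) : IsSignature p β c 1 := by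
  rw [signature] at h
  split_ifs at h with hex
  · rw [← h]
    exact hex.choose_spec
  · exact absurd h zero_ne_one

/-- Signature `1` and index `1` determine the action of `J_α c` on the kernel of `T(c)`. -/
lemma eq_zero_of_ind_eq_one (hβ : 1 < ‖β‖) (hP : IsRieszProj p (rieszProj p)) (hp : p ≠ ∞)
    (hc : MemLp c ∞ mT) (hc0 : ∀ᵐ θ ∂mT, c θ ≠ 0) (hi : ind (toeplitz p c) = 1)
    (hσ : signature p β c = 1) :
    coker (toeplitz p c) = ⊥ ∧
      ∀ f ∈ hardy p, mulOp p c f = -weightedShift p β hβ f → f = 0 := by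
  obtain ⟨gm, gp, W, hξ⟩ := isSignature_of_signature_eq_one hσ
  rw [hi] at W hξ
  have hl := lam_ne_zero β hβ
  have hb := conj_ne_zero hβ
  set u : LpT p := W.plus_inv_mem.1.toLp
  have hu : u =ᵐ[mT] fun θ => (gp θ)⁻¹ := W.plus_inv_mem.1.coeFn_toLp
  have huH : u ∈ hardy p := fun n hn => by
    rw [fourierCoeff_congr_ae hu]
    exact W.plus_inv_mem.2 n hn
  have hcu : mulOp p c u =ᵐ[mT] fun θ => pt θ ^ (-1 : ℤ) * gm θ := by
    filter_upwards [coeFn_mulOp p hc u, hu, W.factor, W.plus_ne] with θ h1 h2 h3 h4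
    rw [h1, h2, h3]
    field_simp
  have hcoef : ∀ n, fourierCoeff (mulOp p c u) n = fourierCoeff gm (n + 1) := fun n => by
    rw [fourierCoeff_congr_ae hcu, fourierCoeff_zpow_mul, sub_neg_eq_add]
  have hPcu : rieszProj p (mulOp p c u) = 0 := by
    rw [rieszProj_eq_zero_iff hP]
    intro n hn
    rw [hcoef]
    exact W.minus_mem.2 _ (by omega)
  have hval : lam β / conj β * diskValue u (1 / conj β) = 1 := by
    rw [diskValue_congr_ae hu, ← zpow_one (lam β / conj β)]
    exact hξ.symm
  have hu0 : u ≠ 0 := by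
    intro h0
    have : diskValue u (1 / conj β) = 0 := by
      rw [h0, diskValue_congr_ae (Lp.coeFn_zero ℂ p mT)]
      simp [diskValue, fourierCoeff]
    rw [this, mul_zero] at hval
    exact zero_ne_one hval
  have hker : (⟨u, huH⟩ : hardy p) ∈ (toeplitz p c).ker := hPcu
  have hcok := coker_toeplitz_eq_bot hP hp hc hc0 hker (fun h => hu0 (congrArg Subtype.val h))
  refine ⟨hcok, fun f hf hcf => ?_⟩
  have hdim : Module.finrank ℂ (toeplitz p c).ker = 1 := by
    rw [ind, hcok, finrank_bot] at hi
    omega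
  have hfker : (⟨f, hf⟩ : hardy p) ∈ (toeplitz p c).ker := by
    change rieszProj p (mulOp p c f) = 0
    rw [hcf, map_neg, rieszProj_weightedShift β hβ hP hp hf, neg_zero]
  obtain ⟨k, hk⟩ := (finrank_eq_one_iff_of_nonzero' (⟨⟨u, huH⟩, hker⟩ : (toeplitz p c).ker)
    (fun h => hu0 (congrArg (fun x => (x.1 : LpT p)) h))).mp hdim ⟨⟨f, hf⟩, hfker⟩
  have hfu : k • u = f := congrArg (fun x => (x.1 : LpT p)) hk
  rcases eq_or_ne k 0 with rfl | hk0
  · rw [← hfu, zero_smul]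
  exfalso
  have h1 : mulOp p c u = -weightedShift p β hβ u := by
    rw [← hfu, map_smul, map_smul, ← smul_neg] at hcf
    exact smul_right_injective _ hk0 hcf
  -- The value of `J_α (c u)` at `1 / conj β` is `conj β / λ`, since `c u = t⁻¹ g₋` and `g₋(∞) = 1`.
  -- The signature gives `u` the same value there, but `J_α (c u) = -u` would require the opposite
  -- one.
  have h2 := diskValue_weightedShift β hβ hP hp hPcu
  rw [hcoef, neg_add_cancel, W.minus_infty, mul_one, h1, map_neg, weightedShift_weightedShift] at h2
  have h3 : (-u : LpT p) =ᵐ[mT] fun θ => (-1) * u θ := by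
    filter_upwards [Lp.coeFn_neg u] with θ hθ
    rw [hθ, Pi.neg_apply, neg_one_mul]
  rw [diskValue_congr_ae h3, diskValue_const_mul] at h2
  have h4 : lam β / conj β * (conj β / lam β) = 1 := by field_simp
  rw [← h2] at h4
  have h5 : (1 : ℂ) = -1 := by linear_combination (-1 : ℂ) * h4 - hval
  norm_num at h5

/-- Signature `1` and index `-1` determine the action of `c J_α` on the cokernel of `T(c)`. -/
lemma eq_zero_of_ind_eq_neg_one (hβ : 1 < ‖β‖) (hP : IsRieszProj p (rieszProj p)) (hp : p ≠ ∞)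
    (hc : MemLp c ∞ mT) (hc0 : ∀ᵐ θ ∂mT, c θ ≠ 0) (hi : ind (toeplitz p c) = -1)
    (hσ : signature p β c = 1) :
    (toeplitz p c).ker = ⊥ ∧
      ∀ Θ : LpT p →L[ℂ] ℂ, (∀ f, rieszProj p f = 0 → Θ f = 0) →
        (∀ f ∈ hardy p, Θ (mulOp p c f) = 0) →
        (∀ f, Θ (mulOp p c (weightedShift p β hβ f)) = -Θ f) → Θ = 0 := by
  obtain ⟨gm, gp, W, hξ⟩ := isSignature_of_signature_eq_one hσ
  rw [hi, neg_neg] at W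
  rw [hi, zpow_neg_one] at hξ
  have hl := lam_ne_zero β hβ
  have hb := conj_ne_zero hβ
  have hw := norm_one_div_conj_lt hβ
  have hgp : MemLp (fun θ => pt θ * gp θ) p.conjExponent mT :=
    W.plus_mem.1.mul (memLp_of_continuous continuous_pt ∞)
  -- As `g₋⁻¹ c = t g₊`, this functional kills `ker P` and, after multiplication by `c`, kills
  -- `H^p`; it will span the cokernel.
  set Θ₀ : LpT p →L[ℂ] ℂ := pairing W.minus_inv_mem.1 with hΘ₀
  have hΘ₀P : ∀ f, rieszProj p f = 0 → Θ₀ f = 0 := by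
    intro f hf
    refine clm_eq_zero_on_ker hP hp Θ₀ (fun n hn => ?_) hf
    rw [hΘ₀, pairing_apply, ← W.minus_inv_mem.2 (-n) (by omega), fourierCoeff_eq, neg_neg]
    refine integral_congr_ae ?_
    filter_upwards [coeFn_fourierLp' (p := p) n] with θ hθ
    rw [hθ, mul_comm]
  have hΘ₀c : ∀ f, Θ₀ (mulOp p c f) = pairing hgp f := by
    intro f
    rw [hΘ₀, pairing_apply, pairing_apply]
    refine integral_congr_ae ?_
    filter_upwards [coeFn_mulOp p hc f, W.factor, W.minus_ne] with θ h1 h2 h3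
    rw [h1, h2, zpow_one]
    field_simp
  have hΘ₀H : ∀ f ∈ hardy p, Θ₀ (mulOp p c f) = 0 := by
    intro f hf
    rw [hΘ₀c]
    refine clm_eq_zero_on_hardy hP hp (pairing hgp) (fun n hn => ?_) hf
    rw [pairing_apply, ← W.plus_mem.2 (-(n + 1)) (by omega), fourierCoeff_eq, neg_neg]
    refine integral_congr_ae ?_
    filter_upwards [coeFn_fourierLp' (p := p) n] with θ hθ
    rw [hθ, zpow_add_one₀ (pt_ne_zero θ)]
    ring
  set e₀ : LpT p := fourierLp p 0
  have he₀ : e₀ =ᵐ[mT] fun _ => 1 := by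
    filter_upwards [coeFn_fourierLp' (p := p) 0] with θ hθ
    rw [hθ, zpow_zero]
  -- `g₋ - 1` has only negative frequencies, so `Θ₀` takes the same value at `1` and at `g₋`, namely
  -- `∫ g₋⁻¹ g₋ = 1`.
  have hΘ₀1 : Θ₀ e₀ = 1 := by
    set g : LpT p := W.minus_mem.1.toLp
    have hg : g =ᵐ[mT] gm := W.minus_mem.1.coeFn_toLp
    have h1 : rieszProj p (g - e₀) = 0 := by
      rw [rieszProj_eq_zero_iff hP]
      intro n hn
      rw [fourierCoeff_congr_ae (Lp.coeFn_sub g e₀)]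
      refine (fourierCoeff_sub' (integrable_coeFn p g) (integrable_coeFn p e₀) n).trans ?_
      rw [fourierCoeff_congr_ae hg, fourierCoeff_fourierLp]
      rcases hn.eq_or_lt with rfl | hn
      · rw [W.minus_infty, if_pos rfl, sub_self]
      · rw [W.minus_mem.2 n hn, if_neg hn.ne', sub_self]
    have h2 := hΘ₀P _ h1
    rw [map_sub, sub_eq_zero] at h2
    rw [← h2, hΘ₀, pairing_apply]
    have h3 : (fun θ => (gm θ)⁻¹ * g θ) =ᵐ[mT] fun _ => (1 : ℂ) := by
      filter_upwards [hg, W.minus_ne] with θ h1 h2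
      rw [h1, inv_mul_cancel₀ h2]
    rw [integral_congr_ae h3]
    simp
  -- The signature prescribes the value of `g₊⁻¹`; multiplicativity of evaluation transfers it to
  -- `g₊`.
  have hval : diskValue gp (1 / conj β) * (lam β / conj β) = 1 := by
    set u : LpT p := W.plus_inv_mem.1.toLp
    have hu : u =ᵐ[mT] fun θ => (gp θ)⁻¹ := W.plus_inv_mem.1.coeFn_toLp
    have huH : u ∈ hardy p := fun n hn => by
      rw [fourierCoeff_congr_ae hu]
      exact W.plus_inv_mem.2 n hn
    have h1 := diskValue_mul hP hp hw huH W.plus_mem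
    have h2 : (fun θ => gp θ * u θ) =ᵐ[mT] fun _ => (1 : ℂ) := by
      filter_upwards [hu, W.plus_ne] with θ h1 h2
      rw [h1, mul_inv_cancel₀ h2]
    have h3 : lam β / conj β = diskValue u (1 / conj β) := by
      rw [← diskValue_congr_ae hu] at hξ
      field_simp at hξ ⊢
      linear_combination hξ
    rw [h3, ← h1, diskValue_congr_ae h2, diskValue_one]
  -- The integrand `t g₊ λ / (conj β t - 1)` is `λ / conj β` times the Cauchy kernel of `1 / conj β`
  -- times `g₊`.
  have hΘ₀J : Θ₀ (mulOp p c (weightedShift p β hβ e₀)) = 1 := by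
    have hgpi : Integrable gp mT :=
      W.plus_mem.1.integrable (ENNReal.HolderConjugate.one_le p.conjExponent p)
    rw [hΘ₀c, pairing_apply, ← hval, diskValue_eq_integral hw hgpi, ← integral_mul_const]
    refine integral_congr_ae ?_
    filter_upwards [coeFn_weightedShift_fourierLp (p := p) β hβ 0] with θ hθ
    have hd := den_ne hβ (norm_pt θ)
    have hs := pt_sub_ne_zero hw θ
    rw [hθ, zpow_zero, cauchyKernel]
    have hk : pt θ - 1 / conj β = (conj β * pt θ - 1) / conj β := by field_simp
    rw [hk]
    field_simp
  have hφ₀ := comp_subtypeL_mem_coker hP hΘ₀P hΘ₀H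
  set φ₀ := Θ₀ ∘L (hardy p).subtypeL
  have hφ₀0 : φ₀ ≠ 0 := by
    intro h0
    have h1 : Θ₀ e₀ = 0 := DFunLike.congr_fun h0 ⟨e₀, fourierLp_mem_hardy le_rfl⟩
    rw [hΘ₀1] at h1
    exact one_ne_zero h1
  have hker := ker_toeplitz_eq_bot hP hp hc hc0
    (fun h => hφ₀0 ((Submodule.eq_bot_iff _).mp h _ hφ₀))
  refine ⟨hker, fun Θ hΘP hΘH hΘJ => ?_⟩
  have hdim : Module.finrank ℂ (coker (toeplitz p c)) = 1 := by
    rw [ind, hker, finrank_bot] at hi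
    omega
  obtain ⟨k, hk⟩ := (finrank_eq_one_iff_of_nonzero' (⟨φ₀, hφ₀⟩ : coker (toeplitz p c))
    (fun h => hφ₀0 (congrArg Subtype.val h))).mp hdim ⟨_, comp_subtypeL_mem_coker hP hΘP hΘH⟩
  have hk' : k • φ₀ = Θ ∘L (hardy p).subtypeL := congrArg Subtype.val hk
  have hΘ : ∀ f, Θ f = k * Θ₀ f := by
    intro f
    rw [← apply_rieszProj hP hΘP, ← apply_rieszProj hP hΘ₀P]
    exact (DFunLike.congr_fun hk' (rieszProj p f)).symm
  have h1 := hΘJ e₀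
  rw [hΘ, hΘ, hΘ₀J, hΘ₀1] at h1
  -- Tested at the constant `1`, the relation for `Θ = k Θ₀` becomes `k = -k`.
  have hk0 : k = 0 := by linear_combination (1 / 2 : ℂ) * h1
  ext f
  rw [hΘ, hk0, zero_mul]
  rfl

end Signature

end ToeplitzHankel

end

/-! ### The three cases of the index -/

open ToeplitzHankel in
theorem proposition5p5 (β : ℂ) (hβ : 1 < ‖β‖) (p : ℝ≥0∞) [Fact (1 ≤ p)] (hp : 1 < p)
    (hp_top : p ≠ ∞) (a b : Torus → ℂ) (hab : IsMatchingPair β hβ a b)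
    (hc : (toeplitz p (subordinated a b)).IsFredholm) :
    (ind (toeplitz p (subordinated a b)) = 1 → signature p β (subordinated a b) = 1 →
      (toeplitz p a + hankel p β hβ b).ker = ⊥ ∨ coker (toeplitz p a + hankel p β hβ b) = ⊥) ∧
    (ind (toeplitz p (subordinated a b)) = -1 → signature p β (subordinated a b) = 1 →
      (toeplitz p a - hankel p β hβ b).ker = ⊥ ∨ coker (toeplitz p a - hankel p β hβ b) = ⊥) ∧
    (ind (toeplitz p (subordinated a b)) = 0 →
      ((toeplitz p a + hankel p β hβ b).ker = ⊥ ∨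
        coker (toeplitz p a + hankel p β hβ b) = ⊥) ∧
      ((toeplitz p a - hankel p β hβ b).ker = ⊥ ∨
        coker (toeplitz p a - hankel p β hβ b) = ⊥)) := by
  have hP := isRieszProj_of_isFredholm hc
  have hcm := hab.subordinated_mem
  have hc0 := hab.subordinated_ne_zero
  have hplus : toeplitz p a + hankel p β hβ b = toeplitz p a + (1 : ℂ) • hankel p β hβ b := by
    rw [one_smul]
  have hminus : toeplitz p a - hankel p β hβ b =
      toeplitz p a + (-1 : ℂ) • hankel p β hβ b := by
    ext1 f
    change toeplitz p a f - hankel p β hβ b f = toeplitz p a f + (-1 : ℂ) • hankel p β hβ b f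
    rw [neg_one_smul, sub_eq_add_neg]
  rw [hplus, hminus]
  refine ⟨fun hi hσ => ?_, fun hi hσ => ?_, fun hi => ?_⟩
  · obtain ⟨hcok, hK⟩ := eq_zero_of_ind_eq_one hβ hP hp_top hcm hc0 hi hσ
    refine ker_eq_bot_or_coker_eq_bot hP hp_top hab (by norm_num) (fun f hf h => hK f hf ?_)
      -- For index `1` the cokernel of `T(c)` is trivial, so the signature is spent on the kernel
      -- side; for index `-1` the roles are reversed.
      (fun Θ h1 h2 _ => eq_zero_of_coker_eq_bot hP hcok h1 h2)
    rw [h, one_smul]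
  · obtain ⟨hker, hC⟩ := eq_zero_of_ind_eq_neg_one hβ hP hp_top hcm hc0 hi hσ
    refine ker_eq_bot_or_coker_eq_bot hP hp_top hab (by norm_num) (fun f hf h => ?_)
      (fun Θ h1 h2 h3 => hC Θ h1 h2 fun f => by rw [h3, neg_one_mul])
    exact eq_zero_of_ker_toeplitz_eq_bot hβ hP hp_top hker hf h
  · obtain ⟨hker, hcok⟩ := ker_coker_eq_bot_of_ind_eq_zero hP hp_top hcm hc0 hc hi
    constructor <;>
    exact ker_eq_bot_or_coker_eq_bot hP hp_top hab (by norm_num)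
      (fun f hf h => eq_zero_of_ker_toeplitz_eq_bot hβ hP hp_top hker hf h)
      (fun Θ h1 h2 _ => eq_zero_of_coker_eq_bot hP hcok h1 h2)
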